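/- Call a real square matrix $X=(x_{ij})$ \emph{Metzler} if $x_{ij}\ge 0$ for all $i\neq j$, and \emph{upper Hessenberg} if $x_{ij}=0$ for all $i,j$ with $i>j+1$. \textbf{Theorem.} For every Metzler matrix $A\in\mathbb{R}^{4\times 4}$ there exists an invertible matrix $T\in\mathbb{R}^{4\times 4}$ with nonnegative entries such that $T^{-1}AT$ is both Metzler and upper Hessenberg. -/

import Mathlib

/-- A real square matrix is Metzler if all its off-diagonal entries are nonnegative. -/
def Matrix.IsMetzler {n : ℕ} (X : Matrix (Fin n) (Fin n) ℝ) : Prop :=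
  ∀ i j, i ≠ j → 0 ≤ X i j

/-- A real square matrix is upper Hessenberg if its `(i, j)` entry vanishes whenever
`i > j + 1` (indices are compared as natural numbers). -/
def Matrix.IsUpperHessenberg {n : ℕ} (X : Matrix (Fin n) (Fin n) ℝ) : Prop :=
  ∀ i j : Fin n, (j : ℕ) + 1 < (i : ℕ) → X i j = 0

/-- A real matrix is entrywise nonnegative. -/
def Matrix.IsNonneg {m n : ℕ} (X : Matrix (Fin m) (Fin n) ℝ) : Prop :=
  ∀ i j, 0 ≤ X i j

/-!
The matrices `T` and `H` are produced with `A * T = T * H`, which is the predicate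
`Matrix.HasMetzlerHessenberg`. It is invariant under adding multiples of the identity to `A` and
under permutations of the coordinates.

**Irreducible matrices.** Subtract a multiple of the identity so that `tr A = 0`. By
Perron-Frobenius there is `v > 0` with `A v = l v`, and every other real eigenvalue is below `l`
(`IsIndecomposable.lt_of_vecMul_eq`). The vector `v` makes signs of basis vectors irrelevant: if
`A S = S H` for some invertible real `S`, and `H` has a positive left eigenvector `z` for `l`, then
`S + K v zᵀ` is another such similarity and is positive for large `K`
(`HasMetzlerHessenberg.of_similar`). So only the spectrum of `A` matters.

* If all eigenvalues are real, `A` is triangular in a basis that starts with `v`, and large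
  multiples of `v` can be added to the other basis vectors
  (`HasMetzlerHessenberg.of_upperTriangular`).
* If the eigenvalues are `l`, a real `c < l` and a nonreal pair, then `A` is similar to the
  companion matrix of `X⁴ + k₂ X² + k₃ X + k₄ = (X - l) (X - c) Q`, and this polynomial is realized
  by a suitable `H` in `exists_hessenberg_similar_companionFour`. If `k₃, k₄ ≤ 0` the companion
  matrix itself serves. If `k₄ > 0` then `c > 0`, and `H` is a `3`-cycle attached to `c`; this needs
  `4 c² ≤ 3 tr A²`, which holds because one of the two sign sets of a left eigenvector for `c` has
  at most two elements, so that a principal block of order at most two has an eigenvalue at least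
  `c` (`four_mul_sq_le_three_mul_trace`). If `k₃ > 0`, subtracting from the polynomial its
  nonpositive value at a critical point `m` gives `(X - m)²` times a quadratic with real roots, and
  `H` is a bidiagonal matrix for this product up to one `2`-cycle, with a corner entry closing a
  `4`-cycle. This needs the polynomial to have three real critical points, which follows from
  `3 (tr A³)² ≤ (tr A²)³` (`three_mul_trace_cube_sq_le`).

**Reducible matrices.** If some coordinate line is invariant, the theorem follows from its
elementary `3 × 3` analogue, and if some coordinate plane is invariant, a permutation suffices. What
remains is an irreducible `3 × 3` block `B` with a column `g` and a corner entry `d` attached to it.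
A Hessenberg basis of `B` is extended by a vector `(x, 1)`, for which `x ≥ 0` has to be chosen such
that `(B - d) x + g` lies in the cone of that basis
(`HasMetzlerHessenberg.of_last_row_eq_zero_of_isIndecomposable`).
-/

namespace Matrix

open Finset

/-! ### Matrices with a Hessenberg basis -/

/-- `A` is similar to an upper Hessenberg Metzler matrix `H` through an invertible nonnegative
matrix `T`; the similarity is written without inverses as `A * T = T * H`. -/
def HasMetzlerHessenberg {n : ℕ} (A : Matrix (Fin n) (Fin n) ℝ) : Prop :=
  ∃ T H : Matrix (Fin n) (Fin n) ℝ,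
    T.IsNonneg ∧ IsUnit T.det ∧ H.IsMetzler ∧ H.IsUpperHessenberg ∧ A * T = T * H

lemma HasMetzlerHessenberg.of_sub_smul_one {n : ℕ} {A : Matrix (Fin n) (Fin n) ℝ} (t : ℝ)
    (h : (A - t • 1).HasMetzlerHessenberg) : A.HasMetzlerHessenberg := by
  obtain ⟨T, H, hT, hdet, hM, hH, e⟩ := h
  refine ⟨T, H + t • 1, hT, hdet, ?_, ?_, ?_⟩
  · intro i j hij
    simpa [Matrix.one_apply_ne hij] using hM i j hij
  · intro i j hij
    have : i ≠ j := by rintro rfl; omega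
    simpa [Matrix.one_apply_ne this] using hH i j hij
  · rw [mul_add, ← e, sub_mul]
    simp

lemma HasMetzlerHessenberg.of_submatrix {n : ℕ} {A : Matrix (Fin n) (Fin n) ℝ}
    (e : Equiv.Perm (Fin n)) (h : (A.submatrix e e).HasMetzlerHessenberg) :
    A.HasMetzlerHessenberg := by
  obtain ⟨T, H, hT, hdet, hM, hH, h⟩ := h
  refine ⟨T.submatrix e.symm id, H, fun i j => hT _ _, ?_, hM, hH, ?_⟩
  · rw [Matrix.det_permute]
    exact ((Equiv.Perm.sign e.symm).isUnit.map (Int.castRingHom ℝ)).mul hdet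
  · have := congrArg (fun X => X.submatrix e.symm id) h
    simp only [Matrix.submatrix_mul _ _ _ _ _ Function.bijective_id,
      Matrix.submatrix_id_id] at this
    rw [← this, Matrix.submatrix_submatrix]
    have h2 : A.submatrix (⇑e ∘ ⇑e.symm) (⇑e ∘ id) * T = A * T.submatrix e.symm id := by
      ext i j
      simp only [Matrix.mul_apply, Matrix.submatrix_apply, Function.comp, Equiv.apply_symm_apply,
        id]
      exact Fintype.sum_equiv e _ _ (by simp)
    exact h2.symm

lemma exists_forall_ge_of_finite {ι : Type*} [Finite ι] (f g : ι → ℝ) (hg : ∀ i, 0 < g i) :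
    ∃ K₀ : ℝ, ∀ K ≥ K₀, ∀ i, 0 ≤ f i + K * g i := by
  have h : ∀ᶠ K : ℝ in Filter.atTop, ∀ i, 0 ≤ f i + K * g i := by
    rw [Filter.eventually_all]
    intro i
    filter_upwards [Filter.eventually_ge_atTop (-f i / g i)] with K hK
    rw [div_le_iff₀ (hg i)] at hK
    linarith
  exact Filter.eventually_atTop.1 h

/-- If `A v = r v` with `v > 0` and `z H = r z` with `z > 0`, then a similarity `S` from `A` to `H`
may be replaced by `S + K • v zᵀ`, which is positive for large `K`. -/
lemma HasMetzlerHessenberg.of_similar {n : ℕ} {A S H : Matrix (Fin n) (Fin n) ℝ}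
    {v z : Fin n → ℝ} {r : ℝ} (hv : ∀ i, 0 < v i) (hAv : A *ᵥ v = r • v)
    (hz : ∀ i, 0 < z i) (hzH : z ᵥ* H = r • z) (hS : IsUnit S.det) (h : A * S = S * H)
    (hM : H.IsMetzler) (hH : H.IsUpperHessenberg) : A.HasMetzlerHessenberg := by
  obtain ⟨K₀, hK₀⟩ := exists_forall_ge_of_finite (fun p : Fin n × Fin n => S p.1 p.2)
    (fun p => v p.1 * z p.2) (fun p => mul_pos (hv _) (hz _))
  have hdet : ∀ K : ℝ, (S + K • vecMulVec v z).det = S.det * (1 + K * (z ⬝ᵥ (S⁻¹ *ᵥ v))) := by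
    intro K
    have := det_add_replicateCol_mul_replicateRow (ι := Unit) hS (K • v) z
    rw [← vecMulVec_eq] at this
    rw [← smul_vecMulVec, this, det_unique (n := Unit), add_apply, Matrix.mul_assoc,
      ← replicateCol_mulVec, replicateRow_mul_replicateCol_apply, mulVec_smul, dotProduct_smul]
    simp
  -- the determinant vanishes for at most one value of `K`
  obtain ⟨K, hK, hne⟩ : ∃ K ≥ K₀, 1 + K * (z ⬝ᵥ (S⁻¹ *ᵥ v)) ≠ 0 := by
    by_cases h0 : 1 + K₀ * (z ⬝ᵥ (S⁻¹ *ᵥ v)) = 0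
    · refine ⟨K₀ + 1, by linarith, fun h1 => ?_⟩
      have : z ⬝ᵥ (S⁻¹ *ᵥ v) = 0 := by linarith
      simp [this] at h0
    · exact ⟨K₀, le_rfl, h0⟩
  refine ⟨S + K • vecMulVec v z, H, ?_, ?_, hM, hH, ?_⟩
  · intro i j
    simpa [vecMulVec_apply] using hK₀ K hK (i, j)
  · rw [hdet]
    exact hS.mul (isUnit_iff_ne_zero.2 hne)
  · rw [mul_add, add_mul, h, Matrix.mul_smul, Matrix.smul_mul, mul_vecMulVec, vecMulVec_mul, hAv,
      hzH, smul_vecMulVec, vecMulVec_smul]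

/-! ### Perron eigenvectors of irreducible Metzler matrices -/

section

/-- No proper nonempty set `S` of coordinates spans an `A`-invariant subspace: some entry of `A`
leads from `S` to its complement. This is irreducibility, stated without graphs and for matrices
whose diagonal may be negative. -/
def IsIndecomposable {n : Type*} [Fintype n] (A : Matrix n n ℝ) : Prop :=
  ∀ S : Finset n, S.Nonempty → S ≠ univ → ∃ i ∉ S, ∃ j ∈ S, A i j ≠ 0

variable {n : Type*} [Fintype n]

lemma IsIndecomposable.pos_of_mulVec_eq {A : Matrix n n ℝ} (hA : A.IsIndecomposable)
    (hM : ∀ i j, i ≠ j → 0 ≤ A i j) {z : n → ℝ} (hz : ∀ i, 0 ≤ z i) (hz0 : z ≠ 0) {r : ℝ}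
    (h : A *ᵥ z = r • z) (i : n) : 0 < z i := by
  classical
  by_contra hi
  have hS1 : (univ.filter fun i => 0 < z i).Nonempty := by
    obtain ⟨j, hj⟩ := Function.ne_iff.1 hz0
    exact ⟨j, by simpa using lt_of_le_of_ne (hz j) (Ne.symm hj)⟩
  have hS2 : (univ.filter fun i => 0 < z i) ≠ univ := by
    intro h
    have := Finset.mem_univ i
    rw [← h] at this
    simp at this
    exact hi this
  obtain ⟨k, hk, l, hl, hkl⟩ := hA _ hS1 hS2
  simp only [mem_filter, mem_univ, true_and, not_lt] at hk hl
  have hk0 : z k = 0 := le_antisymm hk (hz k)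
  have hsum : ∑ j, A k j * z j = 0 := by
    have := congrFun h k
    simpa [mulVec, dotProduct, hk0] using this
  have hnn : ∀ j ∈ univ, 0 ≤ A k j * z j := by
    intro j _
    rcases eq_or_ne k j with rfl | hne
    · simp [hk0]
    · exact mul_nonneg (hM _ _ hne) (hz j)
  have := (sum_eq_zero_iff_of_nonneg hnn).1 hsum l (mem_univ _)
  rcases mul_eq_zero.1 this with h1 | h1
  · exact hkl h1
  · exact hl.ne' h1

/-- Powers of an indecomposable nonnegative matrix with positive diagonal enlarge the support of a
nonnegative vector until it is full. -/
lemma IsIndecomposable.exists_pow_mulVec_pos [DecidableEq n] {C : Matrix n n ℝ}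
    (hC : C.IsIndecomposable) (hnn : ∀ i j, 0 ≤ C i j) (hd : ∀ i, 0 < C i i) {z : n → ℝ}
    (hz : ∀ i, 0 ≤ z i) (hz0 : z ≠ 0) : ∃ k : ℕ, ∀ i, 0 < (C ^ k *ᵥ z) i := by
  classical
  have hpow : ∀ k i, 0 ≤ (C ^ k *ᵥ z) i := by
    intro k
    induction k with
    | zero => simpa using hz
    | succ k ih =>
      intro i
      rw [pow_succ', ← mulVec_mulVec]
      exact sum_nonneg fun j _ => mul_nonneg (hnn i j) (ih j)
  let s : ℕ → Finset n := fun k => univ.filter fun i => 0 < (C ^ k *ᵥ z) i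
  have hstep : ∀ k i j, 0 < C i j → j ∈ s k → i ∈ s (k + 1) := by
    intro k i j hij hj
    simp only [s, mem_filter, mem_univ, true_and] at hj ⊢
    rw [pow_succ', ← mulVec_mulVec]
    exact sum_pos' (fun j _ => mul_nonneg (hnn i j) (hpow k j)) ⟨j, mem_univ _, mul_pos hij hj⟩
  have hmono : ∀ k, s k ⊆ s (k + 1) := fun k i hi => hstep k i i (hd i) hi
  -- pick a power for which the support is as large as possible
  obtain ⟨k, hk⟩ : ∃ k, ∀ l, (s l).card ≤ (s k).card := by
    have hfin : (Set.range fun k => (s k).card).Finite :=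
      (Set.finite_Iic (Fintype.card n)).subset (by
        rintro _ ⟨k, rfl⟩
        exact card_le_univ _)
    obtain ⟨m, ⟨⟨k, rfl⟩, hmax⟩⟩ := hfin.exists_maximal ⟨_, ⟨0, rfl⟩⟩
    refine ⟨k, fun l => ?_⟩
    by_contra hlt
    push Not at hlt
    exact absurd (hmax ⟨l, rfl⟩ hlt.le) (not_le.2 hlt)
  refine ⟨k, fun i => ?_⟩
  by_contra hi
  have hne : (s k).Nonempty := by
    have h0 : (s 0).Nonempty := by
      obtain ⟨j, hj⟩ := Function.ne_iff.1 hz0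
      exact ⟨j, by simpa [s] using lt_of_le_of_ne (hz j) (Ne.symm hj)⟩
    rw [← card_pos] at h0 ⊢
    exact h0.trans_le (hk 0)
  have hnu : s k ≠ univ := by
    intro h
    have := Finset.mem_univ i
    rw [← h] at this
    simp only [s, mem_filter, mem_univ, true_and] at this
    exact hi this
  obtain ⟨a, ha, b, hb, hab⟩ := hC _ hne hnu
  have hlt : s k ⊂ s (k + 1) := by
    refine ⟨hmono k, fun hsub => ha (hsub ?_)⟩
    exact hstep k a b (lt_of_le_of_ne (hnn a b) (Ne.symm hab)) hb
  exact absurd (hk (k + 1)) (not_le.2 (card_lt_card hlt))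

/-- Perron eigenvector of a nonnegative matrix with positive diagonal: a pair `(x, r)` with
`x` in the simplex, `r x ≤ C x` and `r` maximal must satisfy `C x = r x`. -/
lemma IsIndecomposable.exists_pos_eigenvector_of_nonneg [DecidableEq n] [Nonempty n]
    {C : Matrix n n ℝ} (hC : C.IsIndecomposable) (hnn : ∀ i j, 0 ≤ C i j) (hd : ∀ i, 0 < C i i) :
    ∃ (r : ℝ) (v : n → ℝ), (∀ i, 0 < v i) ∧ C *ᵥ v = r • v := by
  classical
  set M : ℝ := ∑ i, ∑ j, C i j
  let P : Set ((n → ℝ) × ℝ) :=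
    (stdSimplex ℝ n ×ˢ Set.Icc 0 M) ∩ {p | ∀ i, p.2 * p.1 i ≤ (C *ᵥ p.1) i}
  have hPc : IsCompact P := by
    refine ((isCompact_stdSimplex ℝ n).prod isCompact_Icc).inter_right ?_
    have : {p : (n → ℝ) × ℝ | ∀ i, p.2 * p.1 i ≤ (C *ᵥ p.1) i} =
        ⋂ i, {p : (n → ℝ) × ℝ | p.2 * p.1 i ≤ ∑ j, C i j * p.1 j} := by
      ext p; simp [mulVec, dotProduct]
    rw [this]
    refine isClosed_iInter fun i => isClosed_le (by fun_prop) (by fun_prop)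
  have hM0 : 0 ≤ M := sum_nonneg fun i _ => sum_nonneg fun j _ => hnn i j
  -- the bound `M` on `r` is automatic
  have hbound : ∀ (x : n → ℝ) (r : ℝ), x ∈ stdSimplex ℝ n → (∀ i, r * x i ≤ (C *ᵥ x) i) →
      r ≤ M := by
    intro x r hx h
    have h1 : ∑ i, r * x i ≤ ∑ i, (C *ᵥ x) i := sum_le_sum fun i _ => h i
    rw [← mul_sum, hx.2, mul_one] at h1
    refine h1.trans (sum_le_sum fun i _ => sum_le_sum fun j _ => ?_)
    have hxj : x j ≤ 1 := by
      rw [← hx.2]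
      exact single_le_sum (f := x) (fun k _ => hx.1 k) (mem_univ j)
    exact mul_le_of_le_one_right (hnn i j) hxj
  have hPn : P.Nonempty := by
    obtain ⟨i⟩ := ‹Nonempty n›
    refine ⟨(Pi.single i 1, 0), ⟨⟨single_mem_stdSimplex ℝ i, le_rfl, hM0⟩, fun k => ?_⟩⟩
    simpa using hnn k i
  obtain ⟨⟨x, r⟩, ⟨⟨hx, hr⟩, hxr⟩, hmax⟩ := hPc.exists_isMaxOn hPn continuous_snd.continuousOn
  simp only [Set.mem_ofPred_eq] at hxr hx hr
  have hx0 : x ≠ 0 := by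
    rintro rfl
    simpa using hx.2
  have key : C *ᵥ x = r • x := by
    by_contra hne
    set z : n → ℝ := C *ᵥ x - r • x with hz
    have hz0 : z ≠ 0 := fun h => hne (sub_eq_zero.1 h)
    have hznn : ∀ i, 0 ≤ z i := fun i => by simpa [hz] using hxr i
    obtain ⟨k, hk⟩ := hC.exists_pow_mulVec_pos hnn hd hznn hz0
    set y := C ^ k *ᵥ x with hy
    have hynn : ∀ i, 0 ≤ y i := by
      have : ∀ k i, 0 ≤ (C ^ k *ᵥ x) i := by
        intro k
        induction k with
        | zero => simpa using hx.1
        | succ k ih =>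
          intro i
          rw [pow_succ', ← mulVec_mulVec]
          exact sum_nonneg fun j _ => mul_nonneg (hnn i j) (ih j)
      exact this k
    have hyz : C *ᵥ y - r • y = C ^ k *ᵥ z := by
      rw [hz, hy, mulVec_sub, mulVec_smul, mulVec_mulVec, mulVec_mulVec, ← pow_succ, ← pow_succ']
    have hy0 : y ≠ 0 := by
      intro h0
      obtain ⟨i⟩ := ‹Nonempty n›
      have := hk i
      rw [← hyz, h0] at this
      simp at this
    have hs : 0 < ∑ i, y i := by
      obtain ⟨j, hj⟩ := Function.ne_iff.1 hy0
      exact sum_pos' (fun i _ => hynn i) ⟨j, mem_univ _, lt_of_le_of_ne (hynn j) (Ne.symm hj)⟩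
    obtain ⟨K, hK⟩ := exists_forall_ge_of_finite (fun i => -y i) _ hk
    have hKp : 0 < max K 1 := lt_max_of_lt_right one_pos
    set y' : n → ℝ := (∑ i, y i)⁻¹ • y with hy'
    have hy's : y' ∈ stdSimplex ℝ n := by
      refine ⟨fun i => mul_nonneg (inv_nonneg.2 hs.le) (hynn i), ?_⟩
      simp only [hy', Pi.smul_apply, smul_eq_mul, ← mul_sum]
      exact inv_mul_cancel₀ hs.ne'
    have hle : ∀ i, (r + (max K 1)⁻¹) * y' i ≤ (C *ᵥ y') i := by
      intro i
      have h1 := hK (max K 1) (le_max_left _ _) i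
      have h2 : (max K 1)⁻¹ * y i ≤ (C ^ k *ᵥ z) i := by
        rw [inv_mul_le_iff₀ hKp]; linarith
      have h3 := congrFun hyz i
      simp only [Pi.sub_apply, Pi.smul_apply, smul_eq_mul] at h3
      rw [hy', mulVec_smul]
      simp only [Pi.smul_apply, smul_eq_mul]
      rw [mul_left_comm]
      refine mul_le_mul_of_nonneg_left ?_ (inv_nonneg.2 hs.le)
      linarith
    have hpos : 0 < (max K 1)⁻¹ := inv_pos.2 hKp
    have hmem : (y', r + (max K 1)⁻¹) ∈ P :=
      ⟨⟨hy's, add_nonneg hr.1 hpos.le, hbound _ _ hy's hle⟩, hle⟩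
    have := hmax hmem
    simp only [Set.mem_ofPred_eq] at this
    linarith
  exact ⟨r, x, hC.pos_of_mulVec_eq (fun i j _ => hnn i j) hx.1 hx0 key, key⟩

lemma IsIndecomposable.exists_pos_eigenvector [DecidableEq n] [Nonempty n] {A : Matrix n n ℝ}
    (hA : A.IsIndecomposable) (hM : ∀ i j, i ≠ j → 0 ≤ A i j) :
    ∃ (r : ℝ) (v : n → ℝ), (∀ i, 0 < v i) ∧ A *ᵥ v = r • v := by
  classical
  set s : ℝ := 1 + ∑ i, |A i i| with hs
  have hsd : ∀ i, 0 < A i i + s := by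
    intro i
    have h1 : |A i i| ≤ ∑ i, |A i i| :=
      single_le_sum (f := fun i => |A i i|) (fun k _ => abs_nonneg _) (mem_univ i)
    have h2 := neg_abs_le (A i i)
    rw [hs]; linarith
  have hoff : ∀ i j, i ≠ j → (A + s • 1) i j = A i j := by
    intro i j hij
    simp [one_apply_ne hij]
  have hdiag : ∀ i, (A + s • 1) i i = A i i + s := by
    intro i
    simp
  obtain ⟨r, v, hv, h⟩ := IsIndecomposable.exists_pos_eigenvector_of_nonneg (C := A + s • 1)
    (fun S h1 h2 => by
      obtain ⟨i, hi, j, hj, hij⟩ := hA S h1 h2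
      have hne : i ≠ j := by rintro rfl; exact hi hj
      exact ⟨i, hi, j, hj, by rwa [hoff _ _ hne]⟩)
    (fun i j => by
      rcases eq_or_ne i j with rfl | hij
      · rw [hdiag]; exact (hsd i).le
      · rw [hoff _ _ hij]; exact hM _ _ hij)
    (fun i => by rw [hdiag]; exact hsd i)
  refine ⟨r - s, v, hv, ?_⟩
  rw [add_mulVec, smul_mulVec, one_mulVec] at h
  rw [sub_smul, ← h]
  simp

end

/-! ### Spectral inequalities for Metzler matrices -/

section

variable {n : Type*} [Fintype n]

lemma dotProduct_mulVec_eigen {A : Matrix n n ℝ} {v : n → ℝ} {r : ℝ} (hAv : A *ᵥ v = r • v)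
    (x : n → ℝ) : (x ᵥ* A) ⬝ᵥ v = r * (x ⬝ᵥ v) := by
  rw [← dotProduct_mulVec, hAv, dotProduct_smul, smul_eq_mul]

/-- The positive part of a left eigenvector is a left subeigenvector. -/
lemma smul_max_le_vecMul_max {A : Matrix n n ℝ} (hM : ∀ i j, i ≠ j → 0 ≤ A i j)
    {y : n → ℝ} {μ : ℝ} (hy : y ᵥ* A = μ • y) (j : n) :
    μ * max (y j) 0 ≤ ((fun i => max (y i) 0) ᵥ* A) j := by
  have h : ∑ i, y i * A i j = μ * y j := by
    simpa [vecMul, dotProduct] using congrFun hy j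
  simp only [vecMul, dotProduct]
  rcases le_or_gt (y j) 0 with h0 | h0
  · rw [max_eq_right h0, mul_zero]
    refine sum_nonneg fun i _ => ?_
    rcases eq_or_ne i j with rfl | hij
    · simp [h0]
    · exact mul_nonneg (le_max_right _ _) (hM _ _ hij)
  · rw [max_eq_left h0.le, ← h]
    refine sum_le_sum fun i _ => ?_
    rcases eq_or_ne i j with rfl | hij
    · rw [max_eq_left h0.le]
    · exact mul_le_mul_of_nonneg_right (le_max_left _ _) (hM _ _ hij)

lemma exists_pos_of_dotProduct_eq_zero {y v : n → ℝ} (hv : ∀ i, 0 < v i) (hy0 : y ≠ 0)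
    (hyv : y ⬝ᵥ v = 0) : ∃ i, 0 < y i := by
  by_contra! h
  have h1 : ∑ i, -(y i) * v i = 0 := by
    simpa [dotProduct] using hyv
  have h2 := (sum_eq_zero_iff_of_nonneg
    (fun i _ => mul_nonneg (neg_nonneg.2 (h i)) (hv i).le)).1 h1
  apply hy0
  ext i
  have := h2 i (mem_univ i)
  rcases mul_eq_zero.1 this with h3 | h3
  · simpa using h3
  · exact absurd h3 (hv i).ne'

/-- A real eigenvalue whose left eigenvector is orthogonal to the Perron vector lies strictly below
the Perron eigenvalue. -/
lemma IsIndecomposable.lt_of_vecMul_eq {A : Matrix n n ℝ} (hA : A.IsIndecomposable)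
    (hM : ∀ i j, i ≠ j → 0 ≤ A i j) {v : n → ℝ} (hv : ∀ i, 0 < v i) {r : ℝ}
    (hAv : A *ᵥ v = r • v) {y : n → ℝ} (hy0 : y ≠ 0) (hyv : y ⬝ᵥ v = 0) {μ : ℝ}
    (hy : y ᵥ* A = μ • y) : μ < r := by
  classical
  obtain ⟨i, hi⟩ := exists_pos_of_dotProduct_eq_zero hv hy0 hyv
  obtain ⟨k, hk⟩ := exists_pos_of_dotProduct_eq_zero (y := -y) hv (neg_ne_zero.2 hy0)
    (by simp [hyv])
  simp only [Pi.neg_apply, neg_pos] at hk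
  set w : n → ℝ := fun i => max (y i) 0 with hw
  have hwv : 0 < w ⬝ᵥ v :=
    sum_pos' (fun i _ => mul_nonneg (le_max_right _ _) (hv i).le)
      ⟨i, mem_univ _, mul_pos (lt_max_of_lt_left hi) (hv i)⟩
  have hsub := smul_max_le_vecMul_max hM hy
  have hA' := dotProduct_mulVec_eigen hAv w
  have hnn : ∀ j ∈ univ, 0 ≤ ((w ᵥ* A) j - μ * w j) * v j := fun j _ =>
    mul_nonneg (sub_nonneg.2 (hsub j)) (hv j).le
  have hsum : ∑ j, ((w ᵥ* A) j - μ * w j) * v j = (r - μ) * (w ⬝ᵥ v) := by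
    rw [sub_mul, ← hA']
    simp only [dotProduct, sub_mul, sum_sub_distrib, mul_sum, mul_assoc]
  have hge : 0 ≤ (r - μ) * (w ⬝ᵥ v) := hsum ▸ sum_nonneg hnn
  by_contra! hle
  -- equality throughout would make the support of `w` an invariant set
  have hz : ∑ j, ((w ᵥ* A) j - μ * w j) * v j = 0 := by
    rw [hsum]
    exact le_antisymm (mul_nonpos_of_nonpos_of_nonneg (by linarith) hwv.le) hge
  have heq : ∀ j, (w ᵥ* A) j = μ * w j := by
    intro j
    have := (sum_eq_zero_iff_of_nonneg hnn).1 hz j (mem_univ j)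
    rcases mul_eq_zero.1 this with h | h
    · linarith
    · exact absurd h (hv j).ne'
  obtain ⟨a, ha, b, hb, hab⟩ := hA (univ.filter fun i => w i = 0)
    ⟨k, by simp [hw, hk.le]⟩ (fun h => by
      have := Finset.mem_univ i
      rw [← h] at this
      simp only [mem_filter, mem_univ, true_and, hw] at this
      exact absurd this (lt_max_of_lt_left hi).ne')
  simp only [mem_filter, mem_univ, true_and] at ha hb
  have h1 := heq b
  rw [hb, mul_zero] at h1
  have h2 : ∀ i ∈ univ, 0 ≤ w i * A i b := by
    intro i _
    rcases eq_or_ne i b with rfl | hib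
    · simp [hb]
    · exact mul_nonneg (le_max_right _ _) (hM _ _ hib)
  have h3 := (sum_eq_zero_iff_of_nonneg h2).1 h1 a (mem_univ a)
  rcases mul_eq_zero.1 h3 with h | h
  · exact ha h
  · exact hab h

/-- Real parts of nonreal eigenvalues do not exceed the Perron eigenvalue: with `y₁ + i y₂` a
complex left eigenvector, the vector of moduli is a left subeigenvector. -/
lemma le_of_vecMul_eq_of_vecMul_eq {A : Matrix n n ℝ} (hM : ∀ i j, i ≠ j → 0 ≤ A i j)
    {v : n → ℝ} (hv : ∀ i, 0 < v i) {r : ℝ} (hAv : A *ᵥ v = r • v) {y₁ y₂ : n → ℝ}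
    (hy0 : y₁ ≠ 0) {a b : ℝ} (h1 : y₁ ᵥ* A = a • y₁ - b • y₂) (h2 : y₂ ᵥ* A = b • y₁ + a • y₂) :
    a ≤ r := by
  set w : n → ℝ := fun i => √(y₁ i ^ 2 + y₂ i ^ 2) with hw
  have hwnn : ∀ i, 0 ≤ w i := fun i => Real.sqrt_nonneg _
  have hw2 : ∀ i, w i * w i = y₁ i ^ 2 + y₂ i ^ 2 := fun i => Real.mul_self_sqrt (by positivity)
  have hcs : ∀ i j, y₁ i * y₁ j + y₂ i * y₂ j ≤ w i * w j := by
    intro i j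
    refine (abs_le_of_sq_le_sq' ?_ (mul_nonneg (hwnn i) (hwnn j))).2
    have : (w i * w j) ^ 2 = (w i * w i) * (w j * w j) := by ring
    rw [this, hw2, hw2]
    nlinarith [sq_nonneg (y₁ i * y₂ j - y₂ i * y₁ j)]
  have hsub : ∀ j, a * w j ≤ (w ᵥ* A) j := by
    intro j
    rcases (hwnn j).eq_or_lt with h0 | h0
    · rw [← h0, mul_zero]
      refine sum_nonneg fun i _ => ?_
      rcases eq_or_ne i j with rfl | hij
      · rw [← h0, zero_mul]
      · exact mul_nonneg (hwnn _) (hM _ _ hij)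
    · have e1 : ∑ i, y₁ i * A i j = a * y₁ j - b * y₂ j := by
        simpa [vecMul, dotProduct] using congrFun h1 j
      have e2 : ∑ i, y₂ i * A i j = b * y₁ j + a * y₂ j := by
        simpa [vecMul, dotProduct] using congrFun h2 j
      have e3 : a * w j * w j = ∑ i, (y₁ i * y₁ j + y₂ i * y₂ j) * A i j := by
        have : ∑ i, (y₁ i * y₁ j + y₂ i * y₂ j) * A i j =
            y₁ j * (∑ i, y₁ i * A i j) + y₂ j * (∑ i, y₂ i * A i j) := by
          rw [mul_sum, mul_sum, ← sum_add_distrib]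
          exact sum_congr rfl fun i _ => by ring
        rw [this, e1, e2, mul_assoc, hw2]
        ring
      refine le_of_mul_le_mul_right ?_ h0
      rw [e3]
      simp only [vecMul, dotProduct]
      rw [sum_mul]
      refine sum_le_sum fun i _ => ?_
      rcases eq_or_ne i j with rfl | hij
      · refine le_of_eq ?_
        rw [mul_right_comm, hw2]
        ring
      · have := mul_le_mul_of_nonneg_right (hcs i j) (hM _ _ hij)
        linarith
  obtain ⟨k, hk⟩ := Function.ne_iff.1 hy0
  have hwk : 0 < w k := Real.sqrt_pos.2 (by
    have : 0 < y₁ k ^ 2 := by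
      simp only [Pi.zero_apply] at hk
      positivity
    positivity)
  have hwv : 0 < w ⬝ᵥ v :=
    sum_pos' (fun i _ => mul_nonneg (hwnn i) (hv i).le) ⟨k, mem_univ _, mul_pos hwk (hv k)⟩
  have := dotProduct_mulVec_eigen hAv w
  have h3 : ∑ j, a * w j * v j ≤ ∑ j, (w ᵥ* A) j * v j :=
    sum_le_sum fun j _ => mul_le_mul_of_nonneg_right (hsub j) (hv j).le
  have h4 : ∑ j, a * w j * v j = a * (w ⬝ᵥ v) := by
    simp only [dotProduct, mul_sum, mul_assoc]
  rw [h4] at h3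
  change _ ≤ (w ᵥ* A) ⬝ᵥ v at h3
  rw [this] at h3
  exact le_of_mul_le_mul_right h3 hwv

/-- The trace of `A²` dominates the contribution of any `2 × 2` principal block of a traceless
Metzler matrix. -/
lemma add_le_trace_mul_self {A : Matrix (Fin 4) (Fin 4) ℝ} (hM : A.IsMetzler)
    (htr : A.trace = 0) (i j : Fin 4) (hij : i ≠ j) :
    A i i ^ 2 + A j j ^ 2 + 2 * (A i j * A j i) + (A i i + A j j) ^ 2 / 2 ≤ (A * A).trace := by
  have h : ∀ i j, i ≠ j → 0 ≤ A i j * A j i := fun i j hij =>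
    mul_nonneg (hM i j hij) (hM j i hij.symm)
  have h01 := h 0 1 (by decide)
  have h02 := h 0 2 (by decide)
  have h03 := h 0 3 (by decide)
  have h12 := h 1 2 (by decide)
  have h13 := h 1 3 (by decide)
  have h23 := h 2 3 (by decide)
  simp only [trace, diag_apply, mul_apply, Fin.sum_univ_four] at htr ⊢
  have s1 : (A 0 0 + A 1 1) ^ 2 = (A 2 2 + A 3 3) ^ 2 := by
    rw [show A 0 0 + A 1 1 = -(A 2 2 + A 3 3) by linarith, neg_sq]
  have s2 : (A 0 0 + A 2 2) ^ 2 = (A 1 1 + A 3 3) ^ 2 := by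
    rw [show A 0 0 + A 2 2 = -(A 1 1 + A 3 3) by linarith, neg_sq]
  have s3 : (A 0 0 + A 3 3) ^ 2 = (A 1 1 + A 2 2) ^ 2 := by
    rw [show A 0 0 + A 3 3 = -(A 1 1 + A 2 2) by linarith, neg_sq]
  have q1 := sq_nonneg (A 0 0 - A 1 1)
  have q2 := sq_nonneg (A 0 0 - A 2 2)
  have q3 := sq_nonneg (A 0 0 - A 3 3)
  have q4 := sq_nonneg (A 1 1 - A 2 2)
  have q5 := sq_nonneg (A 1 1 - A 3 3)
  have q6 := sq_nonneg (A 2 2 - A 3 3)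
  clear htr h hM
  fin_cases i <;> fin_cases j <;> first | exact absurd rfl hij | skip
  all_goals simp only [Fin.mk_zero, Fin.mk_one, Fin.reduceFinMk]
  all_goals linarith

/-- A positive eigenvalue of a traceless `4 × 4` Metzler matrix with a left eigenvector of mixed
signs satisfies `4 c² ≤ 3 tr A²`: one of the sign sets of the eigenvector has at most two elements,
so a principal block of order at most two has a Perron eigenvalue at least `c`. -/
lemma four_mul_sq_le_three_mul_trace {A : Matrix (Fin 4) (Fin 4) ℝ} (hM : A.IsMetzler)
    (htr : A.trace = 0) {y : Fin 4 → ℝ} {c : ℝ} (hc : 0 < c) (hy : y ᵥ* A = c • y)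
    (hpos : ∃ i, 0 < y i) (hneg : ∃ i, y i < 0) : 4 * c ^ 2 ≤ 3 * (A * A).trace := by
  -- a large diagonal entry suffices
  have hdiag : ∀ i, c ≤ A i i → 4 * c ^ 2 ≤ 3 * (A * A).trace := by
    intro i hi
    obtain ⟨j, hj⟩ := exists_ne i
    have := add_le_trace_mul_self hM htr i j hj.symm
    have h2 := mul_nonneg (hM i j hj.symm) (hM j i hj)
    nlinarith [sq_nonneg (A i i + 3 * A j j)]
  wlog hcard : (univ.filter fun i => 0 < y i).card ≤ 2 generalizing y
  · refine this (y := -y) (by rw [neg_vecMul, hy, smul_neg])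
      (by simpa using hneg) (by simpa using hpos) ?_
    have hdisj : Disjoint (univ.filter fun i => 0 < y i) (univ.filter fun i => 0 < (-y) i) := by
      rw [disjoint_filter]
      intro i _ h1 h2
      simp only [Pi.neg_apply] at h2
      linarith
    have := card_union_of_disjoint hdisj
    have h2 := card_le_univ ((univ.filter fun i => 0 < y i) ∪ (univ.filter fun i => 0 < (-y) i))
    rw [Fintype.card_fin] at h2
    omega
  have hsub := smul_max_le_vecMul_max hM hy
  have hsub' : ∀ j, c * max (y j) 0 ≤
      ∑ i ∈ univ.filter fun i => 0 < y i, max (y i) 0 * A i j := by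
    intro j
    refine (hsub j).trans (le_of_eq ?_)
    simp only [vecMul, dotProduct]
    symm
    refine sum_subset (filter_subset _ _) fun i _ hi => ?_
    simp only [mem_filter, mem_univ, true_and, not_lt] at hi
    rw [max_eq_right hi, zero_mul]
  obtain ⟨i, hi⟩ := hpos
  have hne : 0 < (univ.filter fun i => 0 < y i).card :=
    card_pos.2 ⟨i, by simpa using hi⟩
  obtain hc1 | hc2 : (univ.filter fun i => 0 < y i).card = 1 ∨
      (univ.filter fun i => 0 < y i).card = 2 := by omega
  · obtain ⟨k, hk⟩ := card_eq_one.1 hc1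
    have hyk : 0 < y k := by
      have : k ∈ univ.filter fun i => 0 < y i := by rw [hk]; simp
      simpa using this
    have := hsub' k
    rw [hk, sum_singleton, max_eq_left hyk.le, mul_comm] at this
    exact hdiag k (le_of_mul_le_mul_left this hyk)
  · obtain ⟨k, l, hkl, hS⟩ := card_eq_two.1 hc2
    have hyk : 0 < y k := by
      have : k ∈ univ.filter fun i => 0 < y i := by rw [hS]; simp
      simpa using this
    have hyl : 0 < y l := by
      have : l ∈ univ.filter fun i => 0 < y i := by rw [hS]; simp
      simpa using this
    have e1 := hsub' k
    have e2 := hsub' l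
    rw [hS, sum_pair hkl, max_eq_left hyk.le, max_eq_left hyl.le] at e1 e2
    by_cases h1 : c ≤ A k k
    · exact hdiag k h1
    by_cases h2 : c ≤ A l l
    · exact hdiag l h2
    push Not at h1 h2
    have hw : (c - A k k) * (c - A l l) ≤ A k l * A l k := by
      have f1 : (c - A k k) * y k ≤ y l * A l k := by linarith
      have f2 : (c - A l l) * y l ≤ y k * A k l := by linarith
      have f3 := mul_le_mul f1 f2 (mul_nonneg (by linarith) hyl.le)
        (mul_nonneg hyl.le (hM _ _ hkl.symm))
      have f4 : (c - A k k) * (c - A l l) * (y k * y l) ≤ A k l * A l k * (y k * y l) := by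
        linarith
      exact le_of_mul_le_mul_right f4 (mul_pos hyk hyl)
    have := add_le_trace_mul_self hM htr k l hkl
    nlinarith [sq_nonneg (3 * (A k k + A l l) - 2 * c)]

lemma trace_mul_self_nonneg_of_isMetzler {A : Matrix (Fin 4) (Fin 4) ℝ} (hM : A.IsMetzler)
    (htr : A.trace = 0) : 0 ≤ (A * A).trace := by
  have h := add_le_trace_mul_self hM htr 0 1 (by decide)
  have h2 := mul_nonneg (hM 0 1 (by decide)) (hM 1 0 (by decide))
  nlinarith [sq_nonneg (A 0 0), sq_nonneg (A 1 1), sq_nonneg (A 0 0 + A 1 1)]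

/-- The arithmetic-geometric mean estimate behind the bound on the third moment. -/
lemma sq_le_cube_of_abs_le {u v t W a b c : ℝ} (h : |a| + |b| + |c| ≤ W) :
    27 * (u * v * t + u * a + v * b + t * c) ^ 2 ≤ (u ^ 2 + v ^ 2 + t ^ 2 + 2 * W) ^ 3 := by
  have hW : 0 ≤ W := le_trans (by positivity) h
  -- the estimate, once the linear terms are bounded by means of the factor of largest modulus
  have core : ∀ u v t s : ℝ, |s| ≤ |u * v * t| + |t| * W →
      27 * s ^ 2 ≤ (u ^ 2 + v ^ 2 + t ^ 2 + 2 * W) ^ 3 := by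
    intro u v t s hs
    set P := (u ^ 2 + v ^ 2) / 2 + W with hP
    have hP0 : 0 ≤ P := by positivity
    have h1 : |s| ≤ |t| * P := by
      refine hs.trans ?_
      rw [abs_mul, abs_mul]
      have : |u| * |v| ≤ (u ^ 2 + v ^ 2) / 2 := by
        rw [← sq_abs u, ← sq_abs v]
        nlinarith [sq_nonneg (|u| - |v|)]
      rw [hP]
      nlinarith [mul_le_mul_of_nonneg_left this (abs_nonneg t)]
    have h2 : s ^ 2 ≤ t ^ 2 * P ^ 2 := by
      rw [← sq_abs s, ← sq_abs t, ← mul_pow]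
      exact pow_le_pow_left₀ (abs_nonneg _) h1 2
    have h3 : u ^ 2 + v ^ 2 + t ^ 2 + 2 * W = t ^ 2 + 2 * P := by rw [hP]; ring
    rw [h3]
    nlinarith [mul_nonneg (sq_nonneg (t ^ 2 - P)) (by positivity : 0 ≤ t ^ 2 + 8 * P)]
  have hbound : ∀ m : ℝ, |u| ≤ m → |v| ≤ m → |t| ≤ m →
      |u * v * t + u * a + v * b + t * c| ≤ |u * v * t| + m * W := by
    intro m hu hv ht
    have hm : 0 ≤ m := (abs_nonneg u).trans hu
    calc |u * v * t + u * a + v * b + t * c|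
        ≤ |u * v * t| + |u * a| + |v * b| + |t * c| :=
          (abs_add_le _ _).trans (add_le_add_left ((abs_add_le _ _).trans
            (add_le_add_left (abs_add_le _ _) _)) _)
      _ ≤ |u * v * t| + m * |a| + m * |b| + m * |c| := by
          rw [abs_mul u a, abs_mul v b, abs_mul t c]
          gcongr
      _ ≤ |u * v * t| + m * W := by nlinarith
  rcases le_total |u| |t| with hut | hut <;> rcases le_total |v| |t| with hvt | hvt
  · exact core u v t _ (hbound _ hut hvt le_rfl)
  · have := core u t v _
      (by rw [mul_right_comm u t v]; exact hbound _ (hut.trans hvt) le_rfl hvt)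
    linarith
  · have := core t v u _
      (by rw [show t * v * u = u * v * t by ring]; exact hbound _ le_rfl (hvt.trans hut) hut)
    linarith
  · rcases le_total |u| |v| with huv | huv
    · have := core u t v _
        (by rw [mul_right_comm u t v]; exact hbound _ huv le_rfl hvt)
      linarith
    · have := core t v u _
        (by rw [show t * v * u = u * v * t by ring]; exact hbound _ le_rfl huv hut)
      linarith

/-- If the third moment of a traceless `4 × 4` Metzler matrix is negative, it obeys the bound valid
for four real eigenvalues: directed triangles contribute positively to `tr A³`, and what is left
depends only on the diagonal and the products `A i j * A j i`. -/
lemma three_mul_trace_cube_sq_le {A : Matrix (Fin 4) (Fin 4) ℝ} (hM : A.IsMetzler)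
    (htr : A.trace = 0) (h3 : (A * A * A).trace ≤ 0) :
    3 * (A * A * A).trace ^ 2 ≤ (A * A).trace ^ 3 := by
  have h : ∀ i j, i ≠ j → 0 ≤ A i j * A j i := fun i j hij =>
    mul_nonneg (hM i j hij) (hM j i hij.symm)
  have h01 := h 0 1 (by decide)
  have h02 := h 0 2 (by decide)
  have h03 := h 0 3 (by decide)
  have h12 := h 1 2 (by decide)
  have h13 := h 1 3 (by decide)
  have h23 := h 2 3 (by decide)
  have hcyc : ∀ i j k, i ≠ j → j ≠ k → k ≠ i → 0 ≤ A i j * A j k * A k i := fun i j k h1 h2 h3 =>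
    mul_nonneg (mul_nonneg (hM i j h1) (hM j k h2)) (hM k i h3)
  have c1 := hcyc 0 1 2 (by decide) (by decide) (by decide)
  have c2 := hcyc 0 2 1 (by decide) (by decide) (by decide)
  have c3 := hcyc 0 1 3 (by decide) (by decide) (by decide)
  have c4 := hcyc 0 3 1 (by decide) (by decide) (by decide)
  have c5 := hcyc 0 2 3 (by decide) (by decide) (by decide)
  have c6 := hcyc 0 3 2 (by decide) (by decide) (by decide)
  have c7 := hcyc 1 2 3 (by decide) (by decide) (by decide)
  have c8 := hcyc 1 3 2 (by decide) (by decide) (by decide)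
  have hd : A 3 3 = -(A 0 0 + A 1 1 + A 2 2) := by
    simp only [trace, diag_apply, Fin.sum_univ_four] at htr
    linarith
  have habs : ∀ p q : ℝ, 0 ≤ p → 0 ≤ q → |p - q| ≤ p + q := fun p q hp hq =>
    abs_le.2 ⟨by linarith, by linarith⟩
  have key := sq_le_cube_of_abs_le (u := A 0 0 + A 1 1) (v := A 0 0 + A 2 2) (t := A 0 0 + A 3 3)
    (W := A 0 1 * A 1 0 + A 2 3 * A 3 2 + (A 0 2 * A 2 0 + A 1 3 * A 3 1)
      + (A 0 3 * A 3 0 + A 1 2 * A 2 1))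
    (a := A 0 1 * A 1 0 - A 2 3 * A 3 2) (b := A 0 2 * A 2 0 - A 1 3 * A 3 1)
    (c := A 0 3 * A 3 0 - A 1 2 * A 2 1)
    (add_le_add (add_le_add (habs _ _ h01 h23) (habs _ _ h02 h13)) (habs _ _ h03 h12))
  have e2 : (A * A).trace = (A 0 0 + A 1 1) ^ 2 + (A 0 0 + A 2 2) ^ 2 + (A 0 0 + A 3 3) ^ 2 +
      2 * (A 0 1 * A 1 0 + A 2 3 * A 3 2 + (A 0 2 * A 2 0 + A 1 3 * A 3 1)
      + (A 0 3 * A 3 0 + A 1 2 * A 2 1)) := by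
    simp only [trace, diag_apply, mul_apply, Fin.sum_univ_four, hd]
    ring
  have e3 : (A * A * A).trace = 3 * ((A 0 0 + A 1 1) * (A 0 0 + A 2 2) * (A 0 0 + A 3 3)
      + (A 0 0 + A 1 1) * (A 0 1 * A 1 0 - A 2 3 * A 3 2)
      + (A 0 0 + A 2 2) * (A 0 2 * A 2 0 - A 1 3 * A 3 1)
      + (A 0 0 + A 3 3) * (A 0 3 * A 3 0 - A 1 2 * A 2 1)) +
      3 * (A 0 1 * A 1 2 * A 2 0 + A 0 2 * A 2 1 * A 1 0 + A 0 1 * A 1 3 * A 3 0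
        + A 0 3 * A 3 1 * A 1 0 + A 0 2 * A 2 3 * A 3 0 + A 0 3 * A 3 2 * A 2 0
        + A 1 2 * A 2 3 * A 3 1 + A 1 3 * A 3 2 * A 2 1) := by
    simp only [trace, diag_apply, mul_apply, Fin.sum_univ_four, hd]
    ring
  rw [← e2] at key
  refine le_trans ?_ key
  generalize (A 0 0 + A 1 1) * (A 0 0 + A 2 2) * (A 0 0 + A 3 3)
      + (A 0 0 + A 1 1) * (A 0 1 * A 1 0 - A 2 3 * A 3 2)
      + (A 0 0 + A 2 2) * (A 0 2 * A 2 0 - A 1 3 * A 3 1)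
      + (A 0 0 + A 3 3) * (A 0 3 * A 3 0 - A 1 2 * A 2 1) = X at e3 ⊢
  have hle : 3 * X ≤ (A * A * A).trace := by rw [e3]; linarith
  have h9 := pow_le_pow_left₀ (neg_nonneg.2 h3) (neg_le_neg hle) 2
  linarith

end

/-! ### Deflation and real eigenvalues -/

/-- The block upper triangular matrix with corner `a`, remaining first row `r` and lower right
block `P`. -/
def blockUpper {n : ℕ} (a : ℝ) (r : Fin n → ℝ) (P : Matrix (Fin n) (Fin n) ℝ) :
    Matrix (Fin (n + 1)) (Fin (n + 1)) ℝ :=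
  of (Fin.cons (Fin.cons a r) fun i => Fin.cons 0 (P i))

section blockUpper

variable {n : ℕ} (a b : ℝ) (r s : Fin n → ℝ) (P Q : Matrix (Fin n) (Fin n) ℝ)

@[simp] lemma blockUpper_zero_zero : blockUpper a r P 0 0 = a := rfl

@[simp] lemma blockUpper_zero_succ (j : Fin n) : blockUpper a r P 0 j.succ = r j := rfl

@[simp] lemma blockUpper_succ_zero (i : Fin n) : blockUpper a r P i.succ 0 = 0 := rfl

@[simp] lemma blockUpper_succ_succ (i j : Fin n) : blockUpper a r P i.succ j.succ = P i j := rfl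

lemma blockUpper_mul_blockUpper :
    blockUpper a r P * blockUpper b s Q = blockUpper (a * b) (a • s + r ᵥ* Q) (P * Q) := by
  ext i j
  refine Fin.cases ?_ (fun i => ?_) i <;> refine Fin.cases ?_ (fun j => ?_) j <;>
    simp [mul_apply, Fin.sum_univ_succ, vecMul, dotProduct]

lemma det_blockUpper : (blockUpper a r P).det = a * P.det := by
  rw [det_succ_column_zero, Fin.sum_univ_succ]
  simp only [blockUpper_zero_zero, blockUpper_succ_zero, mul_zero, zero_mul, sum_const_zero]
  have : (blockUpper a r P).submatrix (Fin.succAbove 0) Fin.succ = P := by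
    ext i j
    simp
  rw [this]
  simp

lemma eq_blockUpper (M : Matrix (Fin (n + 1)) (Fin (n + 1)) ℝ) (h : ∀ i : Fin n, M i.succ 0 = 0) :
    M = blockUpper (M 0 0) (fun j => M 0 j.succ) (M.submatrix Fin.succ Fin.succ) := by
  ext i j
  refine Fin.cases ?_ (fun i => ?_) i <;> refine Fin.cases ?_ (fun j => ?_) j <;> simp [h]

end blockUpper

lemma exists_isUnit_det_col_zero {n : ℕ} {x : Fin (n + 1) → ℝ} (hx : x ≠ 0) :
    ∃ S : Matrix (Fin (n + 1)) (Fin (n + 1)) ℝ, IsUnit S.det ∧ ∀ i, S i 0 = x i := by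
  obtain ⟨k, hk⟩ := Function.ne_iff.1 hx
  refine ⟨((1 : Matrix _ _ ℝ).updateCol k x).submatrix id (Equiv.swap 0 k), ?_, fun i => ?_⟩
  · rw [det_permute']
    refine ((Equiv.Perm.sign _).isUnit.map (Int.castRingHom ℝ)).mul ?_
    have : ((1 : Matrix _ _ ℝ).updateCol k x).det = x k := by
      have := cramer_apply (1 : Matrix (Fin (n + 1)) (Fin (n + 1)) ℝ) x k
      rw [← this, cramer_one]
      rfl
    rw [this]
    exact isUnit_iff_ne_zero.2 hk
  · simp

/-- Deflation by an eigenvector: in a basis starting with it the matrix is block triangular. -/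
lemma exists_deflation {n : ℕ} {A : Matrix (Fin (n + 1)) (Fin (n + 1)) ℝ} {x : Fin (n + 1) → ℝ}
    (hx : x ≠ 0) {c : ℝ} (h : A *ᵥ x = c • x) :
    ∃ (S : Matrix (Fin (n + 1)) (Fin (n + 1)) ℝ) (r : Fin n → ℝ) (B : Matrix (Fin n) (Fin n) ℝ),
      IsUnit S.det ∧ (∀ i, S i 0 = x i) ∧ A * S = S * blockUpper c r B := by
  obtain ⟨S, hS, hcol⟩ := exists_isUnit_det_col_zero hx
  have hSx : S *ᵥ Pi.single 0 1 = x := by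
    ext i
    simp [hcol]
  have hM : ∀ i, (S⁻¹ * A * S) i 0 = c * (Pi.single 0 1 : Fin (n + 1) → ℝ) i := by
    intro i
    have h1 : (S⁻¹ * A * S) *ᵥ Pi.single 0 1 = c • Pi.single 0 1 := by
      rw [← mulVec_mulVec, hSx, ← mulVec_mulVec, h, mulVec_smul, ← hSx, mulVec_mulVec,
        nonsing_inv_mul _ hS, one_mulVec]
    have := congrFun h1 i
    simpa using this
  have e := eq_blockUpper (S⁻¹ * A * S) (fun i => by rw [hM]; simp)
  have h00 : (S⁻¹ * A * S) 0 0 = c := by rw [hM]; simp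
  rw [h00] at e
  refine ⟨S, fun j => (S⁻¹ * A * S) 0 j.succ, (S⁻¹ * A * S).submatrix Fin.succ Fin.succ, hS,
    hcol, ?_⟩
  rw [← e, Matrix.mul_assoc, ← Matrix.mul_assoc S, mul_nonsing_inv _ hS, one_mul]

lemma exists_cubic_root (a b c : ℝ) : ∃ s : ℝ, s ^ 3 + a * s ^ 2 + b * s + c = 0 := by
  set K := 1 + |a| + |b| + |c| with hK
  have ha := abs_nonneg a
  have hb := abs_nonneg b
  have hc := abs_nonneg c
  have hK1 : 1 ≤ K := by linarith
  have hK2 : K ≤ K ^ 2 := by nlinarith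
  have hcube : K ^ 3 = K ^ 2 + |a| * K ^ 2 + |b| * K ^ 2 + |c| * K ^ 2 := by
    have : K ^ 3 = K * K ^ 2 := by ring
    rw [this]
    nth_rewrite 1 [hK]
    ring
  have b1 : |b| * K ≤ |b| * K ^ 2 := mul_le_mul_of_nonneg_left hK2 hb
  have c1 : |c| ≤ |c| * K ^ 2 := le_mul_of_one_le_right hc (by linarith)
  have a2 : |a * K ^ 2| = |a| * K ^ 2 := by rw [abs_mul, abs_of_nonneg (by positivity : 0 ≤ K ^ 2)]
  have b2 : |b * K| = |b| * K := by rw [abs_mul, abs_of_nonneg (by positivity : 0 ≤ K)]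
  have a3 := abs_le.1 a2.le
  have b3 := abs_le.1 b2.le
  have c3 := abs_le.1 (le_refl |c|)
  have hcont : ContinuousOn (fun s : ℝ => s ^ 3 + a * s ^ 2 + b * s + c) (Set.Icc (-K) K) := by
    fun_prop
  have h0 : (0 : ℝ) ∈ Set.Icc ((-K) ^ 3 + a * (-K) ^ 2 + b * (-K) + c)
      (K ^ 3 + a * K ^ 2 + b * K + c) := by
    have e1 : (-K) ^ 3 = -K ^ 3 := by ring
    have e2 : (-K) ^ 2 = K ^ 2 := by ring
    rw [e1, e2]
    have := sq_nonneg K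
    constructor <;> linarith [a3.1, a3.2, b3.1, b3.2, c3.1, c3.2]
  obtain ⟨s, -, hs⟩ := intermediate_value_Icc (by linarith : -K ≤ K) hcont h0
  exact ⟨s, hs⟩

lemma exists_det_sub_smul_one_eq_zero (B : Matrix (Fin 3) (Fin 3) ℝ) :
    ∃ c : ℝ, (B - c • 1).det = 0 := by
  obtain ⟨c, hc⟩ := exists_cubic_root (-(B 0 0 + B 1 1 + B 2 2))
    (B 0 0 * B 1 1 - B 0 1 * B 1 0 + (B 0 0 * B 2 2 - B 0 2 * B 2 0)
      + (B 1 1 * B 2 2 - B 1 2 * B 2 1)) (-B.det)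
  refine ⟨c, ?_⟩
  rw [det_fin_three] at hc ⊢
  simp
  linarith

lemma exists_mulVec_eq_smul {n : ℕ} {B : Matrix (Fin n) (Fin n) ℝ} {c : ℝ}
    (h : (B - c • 1).det = 0) : ∃ x ≠ 0, B *ᵥ x = c • x := by
  obtain ⟨x, hx, h⟩ := exists_mulVec_eq_zero_iff.2 h
  refine ⟨x, hx, ?_⟩
  rwa [sub_mulVec, smul_mulVec, one_mulVec, sub_eq_zero] at h

/-- Eigenvalues of the deflated block have left eigenvectors orthogonal to the eigenvector used for
the deflation. -/
lemma exists_vecMul_eq_of_deflation {n : ℕ} {A S : Matrix (Fin (n + 1)) (Fin (n + 1)) ℝ}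
    {v : Fin (n + 1) → ℝ} {c : ℝ} {r : Fin n → ℝ} {B : Matrix (Fin n) (Fin n) ℝ}
    (hS : IsUnit S.det) (hcol : ∀ i, S i 0 = v i) (h : A * S = S * blockUpper c r B) {μ : ℝ}
    (hμ : (B - μ • 1).det = 0) : ∃ y ≠ 0, y ⬝ᵥ v = 0 ∧ y ᵥ* A = μ • y := by
  obtain ⟨y, hy0, hy⟩ := exists_vecMul_eq_zero_iff.2 hμ
  rw [vecMul_sub, vecMul_smul, vecMul_one, sub_eq_zero] at hy
  set w : Fin (n + 1) → ℝ := Fin.cons 0 y with hw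
  have hwM : w ᵥ* blockUpper c r B = μ • w := by
    ext j
    refine Fin.cases ?_ (fun j => ?_) j
    · simp [hw, vecMul, dotProduct, Fin.sum_univ_succ]
    · have := congrFun hy j
      simpa [hw, vecMul, dotProduct, Fin.sum_univ_succ] using this
  have hA : S⁻¹ * A = blockUpper c r B * S⁻¹ := by
    have := congrArg (fun X => S⁻¹ * X * S⁻¹) h
    simpa [Matrix.mul_assoc, mul_nonsing_inv _ hS, nonsing_inv_mul_cancel_left _ _ hS] using this
  have hSv : S⁻¹ *ᵥ v = Pi.single 0 1 := by
    have : v = S *ᵥ Pi.single 0 1 := by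
      ext i
      simp [hcol]
    rw [this, mulVec_mulVec, nonsing_inv_mul _ hS, one_mulVec]
  refine ⟨w ᵥ* S⁻¹, ?_, ?_, ?_⟩
  · intro h0
    have : w = 0 := by
      have := congrArg (fun x => x ᵥ* S) h0
      simpa [vecMul_vecMul, nonsing_inv_mul _ hS] using this
    apply hy0
    ext j
    have := congrFun this j.succ
    simpa [hw] using this
  · rw [← dotProduct_mulVec, hSv]
    simp [hw]
  · rw [vecMul_vecMul, hA, ← vecMul_vecMul, hwM, smul_vecMul]

/-- A change of basis inside the deflated block. -/
lemma deflation_trans {n : ℕ} {A S : Matrix (Fin (n + 1)) (Fin (n + 1)) ℝ} {c : ℝ}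
    {r : Fin n → ℝ} {B R U : Matrix (Fin n) (Fin n) ℝ} (hS : IsUnit S.det)
    (h : A * S = S * blockUpper c r B) (hR : IsUnit R.det) (hU : B * R = R * U) :
    ∃ S' : Matrix (Fin (n + 1)) (Fin (n + 1)) ℝ, IsUnit S'.det ∧ (∀ i, S' i 0 = S i 0) ∧
      A * S' = S' * blockUpper c (r ᵥ* R) U := by
  refine ⟨S * blockUpper 1 0 R, ?_, fun i => ?_, ?_⟩
  · rw [det_mul, det_blockUpper, one_mul]
    exact hS.mul hR
  · simp [mul_apply, Fin.sum_univ_succ]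
  · rw [← Matrix.mul_assoc, h, Matrix.mul_assoc, Matrix.mul_assoc, blockUpper_mul_blockUpper,
      blockUpper_mul_blockUpper, hU]
    simp

/-- Every real upper triangular `3 × 3` matrix is similar to one with the same diagonal and
nonnegative entries above it. -/
lemma exists_similar_upperTriangular_nonneg (c d e x y z : ℝ) :
    ∃ (R : Matrix (Fin 3) (Fin 3) ℝ) (x' y' z' : ℝ), IsUnit R.det ∧ 0 ≤ x' ∧ 0 ≤ y' ∧ 0 ≤ z' ∧
      !![c, x, y; 0, d, z; 0, 0, e] * R = R * !![c, x', y'; 0, d, z'; 0, 0, e] := by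
  have hsgn : ∀ t : ℝ, ∃ s : ℝ, s * s = 1 ∧ 0 ≤ s * t := by
    intro t
    rcases le_total 0 t with h | h
    · exact ⟨1, by norm_num, by simpa using h⟩
    · exact ⟨-1, by norm_num, by linarith⟩
  have hunit : ∀ s t : ℝ, s * s = 1 → t * t = 1 → IsUnit (s * t) := fun s t hs ht =>
    (IsUnit.of_mul_eq_one s hs).mul (IsUnit.of_mul_eq_one t ht)
  -- two of the three signs can always be corrected by a diagonal change of basis
  by_cases hz : z = 0
  · obtain ⟨s, hs, hs'⟩ := hsgn x
    obtain ⟨t, ht, ht'⟩ := hsgn y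
    refine ⟨!![1, 0, 0; 0, s, 0; 0, 0, t], s * x, t * y, 0, ?_, hs', ht', le_rfl, ?_⟩
    · rw [det_fin_three]
      simpa using hunit s t hs ht
    · ext i j
      fin_cases i <;> fin_cases j <;> simp [mul_apply, Fin.sum_univ_three, hz, mul_comm]
  · -- here a shear removes the corner entry first
    obtain ⟨s, hs, hs'⟩ := hsgn (x + y / z * (c - d))
    obtain ⟨t, ht, ht'⟩ := hsgn (s * z)
    refine ⟨!![1, y / z * s, 0; 0, s, 0; 0, 0, t], s * (x + y / z * (c - d)), 0, t * (s * z), ?_,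
      hs', le_rfl, ht', ?_⟩
    · rw [det_fin_three]
      simpa using hunit s t hs ht
    · ext i j
      fin_cases i <;> fin_cases j <;> simp [mul_apply, Fin.sum_univ_three]
      · ring
      · have : y / z * s * (t * (s * z)) = (s * s) * (y / z * z) * t := by ring
        rw [this, hs, div_mul_cancel₀ _ hz, one_mul]
      · ring
      · have : s * (t * (s * z)) = (s * s) * (z * t) := by ring
        rw [this, hs, one_mul]
      · ring

/-- If the deflated block is triangular, with nonnegative entries above the diagonal and
eigenvalues below the Perron eigenvalue, then adding large multiples of the Perron vector to the
other basis vectors makes both the basis and the first row of the matrix nonnegative. -/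
lemma HasMetzlerHessenberg.of_upperTriangular {A S : Matrix (Fin 4) (Fin 4) ℝ}
    {v : Fin 4 → ℝ} (hv : ∀ i, 0 < v i) {l c d e x y z : ℝ} {r : Fin 3 → ℝ} (hS : IsUnit S.det)
    (hcol : ∀ i, S i 0 = v i)
    (h : A * S = S * blockUpper l r !![c, x, y; 0, d, z; 0, 0, e])
    (hc : c < l) (hd : d < l) (he : e < l) : A.HasMetzlerHessenberg := by
  obtain ⟨R, x', y', z', hR, hx, hy, hz, hU⟩ := exists_similar_upperTriangular_nonneg c d e x y z
  obtain ⟨S', hS', hcol', h'⟩ := deflation_trans hS h hR hU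
  simp only [hcol] at hcol'
  clear h hS hcol hU
  set U := !![c, x', y'; 0, d, z'; 0, 0, e] with hUdef
  set r' := r ᵥ* R
  -- a positive row vector `w` with `w * (l - U) > 0`
  obtain ⟨w, hw, hwU⟩ : ∃ w : Fin 3 → ℝ, (∀ i, 0 < w i) ∧ ∀ j, 0 < l * w j - (w ᵥ* U) j := by
    have hd' : 0 < l - d := by linarith
    have he' : 0 < l - e := by linarith
    set p := (x' + 1) / (l - d) with hp
    have hp0 : 0 < p := by positivity
    have hp1 : p * (l - d) = x' + 1 := div_mul_cancel₀ _ hd'.ne'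
    set q := (y' + p * z' + 1) / (l - e) with hq
    have hq0 : 0 < q := by positivity
    have hq1 : q * (l - e) = y' + p * z' + 1 := div_mul_cancel₀ _ he'.ne'
    refine ⟨![1, p, q], ?_, ?_⟩
    · intro i
      fin_cases i <;> simp [hp0, hq0]
    · intro j
      fin_cases j <;> simp [hUdef, vecMul, dotProduct, Fin.sum_univ_three] <;> linarith
  obtain ⟨K₁, hK₁⟩ := exists_forall_ge_of_finite (fun p : Fin 4 × Fin 3 => S' p.1 p.2.succ)
    (fun p => v p.1 * w p.2) (fun p => mul_pos (hv _) (hw _))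
  obtain ⟨K₂, hK₂⟩ := exists_forall_ge_of_finite r' (fun j => l * w j - (w ᵥ* U) j) hwU
  set K := max K₁ K₂
  refine ⟨S' * blockUpper 1 (K • w) 1, blockUpper l (fun j => r' j + K * (l * w j - (w ᵥ* U) j)) U,
    ?_, ?_, ?_, ?_, ?_⟩
  · intro i j
    refine Fin.cases ?_ (fun j => ?_) j
    · have : (S' * blockUpper 1 (K • w) 1) i 0 = v i := by
        simp [mul_apply, Fin.sum_univ_succ, hcol']
      rw [this]
      exact (hv i).le
    · have : (S' * blockUpper 1 (K • w) 1) i j.succ = S' i j.succ + K * (v i * w j) := by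
        have h1 : ∑ k : Fin 3, S' i k.succ * (1 : Matrix (Fin 3) (Fin 3) ℝ) k j = S' i j.succ := by
          simp [one_apply]
        rw [mul_apply, Fin.sum_univ_succ]
        simp only [blockUpper_zero_succ, blockUpper_succ_succ, h1, hcol', Pi.smul_apply,
          smul_eq_mul]
        ring
      rw [this]
      exact hK₁ K (le_max_left _ _) (i, j)
  · rw [det_mul, det_blockUpper, det_one, mul_one, mul_one]
    exact hS'
  · intro i j
    refine Fin.cases ?_ (fun i => ?_) i <;> refine Fin.cases ?_ (fun j => ?_) j
    · intro h
      exact absurd rfl h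
    · intro _
      exact hK₂ K (le_max_right _ _) j
    · intro _
      simp
    · intro _
      rw [blockUpper_succ_succ]
      fin_cases i <;> fin_cases j <;> simp_all
  · intro i j
    refine Fin.cases ?_ (fun i => ?_) i <;> refine Fin.cases ?_ (fun j => ?_) j
    · intro h
      simp at h
    · intro h
      simp at h
    · intro _
      simp
    · intro h
      rw [blockUpper_succ_succ]
      fin_cases i <;> fin_cases j <;> simp_all
  · rw [← Matrix.mul_assoc, h', Matrix.mul_assoc, Matrix.mul_assoc, blockUpper_mul_blockUpper,
      blockUpper_mul_blockUpper, one_mul, mul_one, mul_one, one_mul]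
    congr 2
    ext j
    simp [smul_vecMul]
    ring

/-! ### Hessenberg realization of quartic polynomials -/

/-- The companion matrix of the polynomial `X⁴ + k₂ X² + k₃ X + k₄`. -/
def companionFour (k₂ k₃ k₄ : ℝ) : Matrix (Fin 4) (Fin 4) ℝ :=
  !![0, 0, 0, -k₄; 1, 0, 0, -k₃; 0, 1, 0, -k₂; 0, 0, 1, 0]

lemma isUnit_det_unitriangular (a b c d e f : ℝ) :
    IsUnit (!![1, a, b, c; 0, 1, d, e; 0, 0, 1, f; 0, 0, 0, 1] : Matrix (Fin 4) (Fin 4) ℝ).det := by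
  have : (!![1, a, b, c; 0, 1, d, e; 0, 0, 1, f; 0, 0, 0, 1] :
      Matrix (Fin 4) (Fin 4) ℝ).det = 1 := by
    rw [det_of_isUpperTriangular]
    · simp [Fin.prod_univ_four]
    · intro i j h
      fin_cases i <;> fin_cases j <;> simp_all
  rw [this]
  exact isUnit_one

/-- A traceless block triangular matrix with distinct real eigenvalues `l`, `c` and a block without
real eigenvalues is similar to the companion matrix of its characteristic polynomial
`(X - l) (X - c) Q`. The columns of the matrix `F` in the proof are `b`, `M b`, `Q(M) b`,
`(M - c) Q(M) b` for a cyclic vector `b = (β₁, β₂, 1, 0)`. -/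
lemma exists_similar_companionFour {l c p q s t m₁ m₂ m₃ m₄ m₅ : ℝ} (htr : l + c + p + t = 0)
    (hlc : l ≠ c) (hdisc : (p - t) ^ 2 + 4 * (q * s) < 0) :
    ∃ F : Matrix (Fin 4) (Fin 4) ℝ, IsUnit F.det ∧
      !![l, m₁, m₂, m₃; 0, c, m₄, m₅; 0, 0, p, q; 0, 0, s, t] * F =
        F * companionFour (l * c - (l + c) ^ 2 + (p * t - q * s))
          ((l + c) * (l * c - (p * t - q * s))) (l * c * (p * t - q * s)) := by
  have hs : s ≠ 0 := by
    rintro rfl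
    nlinarith [sq_nonneg (p - t)]
  have ht : t = -(l + c) - p := by linarith
  subst ht
  set N := p * (-(l + c) - p) - q * s with hN
  have hQ : ∀ x, x ^ 2 + (l + c) * x + N ≠ 0 := by
    intro x
    have : 0 < x ^ 2 + (l + c) * x + N := by
      nlinarith [sq_nonneg (2 * x + (l + c))]
    exact this.ne'
  have hlc' : l - c ≠ 0 := sub_ne_zero.2 hlc
  -- `β₂` and `β₁` are chosen such that `Q(M) b = (g, 1, 0, 0)` and `(M - c) Q(M) b = (1, 0, 0, 0)`
  obtain ⟨g, hg⟩ : ∃ g, (l - c) * g + m₁ = 1 :=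
    ⟨(1 - m₁) / (l - c), by rw [mul_div_cancel₀ _ hlc']; ring⟩
  obtain ⟨β₂, h₂⟩ : ∃ β, (c ^ 2 + (l + c) * c + N) * β
      + (c * m₄ + m₄ * p + m₅ * s + (l + c) * m₄) = 1 :=
    ⟨(1 - (c * m₄ + m₄ * p + m₅ * s + (l + c) * m₄)) / (c ^ 2 + (l + c) * c + N), by
      rw [mul_div_cancel₀ _ (hQ c)]; ring⟩
  obtain ⟨β₁, h₁⟩ : ∃ β, (l ^ 2 + (l + c) * l + N) * β + (l * (m₁ * β₂ + m₂)
      + m₁ * (c * β₂ + m₄) + m₂ * p + m₃ * s + (l + c) * (m₁ * β₂ + m₂)) = g :=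
    ⟨(g - (l * (m₁ * β₂ + m₂)
      + m₁ * (c * β₂ + m₄) + m₂ * p + m₃ * s + (l + c) * (m₁ * β₂ + m₂))) /
        (l ^ 2 + (l + c) * l + N), by rw [mul_div_cancel₀ _ (hQ l)]; ring⟩
  set F : Matrix (Fin 4) (Fin 4) ℝ := !![β₁, l * β₁ + m₁ * β₂ + m₂, g, 1;
    β₂, c * β₂ + m₄, 1, 0; 1, p, 0, 0; 0, s, 0, 0] with hF
  have hFL : !![l, m₁, m₂, m₃; 0, c, m₄, m₅; 0, 0, p, q; 0, 0, s, -(l + c) - p] * F =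
      F * !![0, -N, 0, 0; 1, -(l + c), 0, 0; 0, 1, c, 0; 0, 0, 1, l] := by
    ext i j
    fin_cases i <;> fin_cases j <;> simp [hF, mul_apply, Fin.sum_univ_four] <;> linarith
  have hLR : !![0, -N, 0, 0; 1, -(l + c), 0, 0; 0, 1, c, 0; 0, 0, 1, l] *
      !![1, 0, -N, (l + c) * N; 0, 1, -(l + c), (l + c) ^ 2 - N; 0, 0, 1, -l; 0, 0, 0, 1] =
      !![1, 0, -N, (l + c) * N; 0, 1, -(l + c), (l + c) ^ 2 - N; 0, 0, 1, -l; 0, 0, 0, 1] *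
      companionFour (l * c - (l + c) ^ 2 + N) ((l + c) * (l * c - N)) (l * c * N) := by
    ext i j
    fin_cases i <;> fin_cases j <;> simp [companionFour, mul_apply, Fin.sum_univ_four] <;> ring
  have hdetF : IsUnit F.det := by
    have : F.det = -s := by
      rw [hF, det_succ_row_zero]
      simp [Fin.sum_univ_succ, det_fin_three, Fin.succAbove]
      ring
    rw [this]
    exact isUnit_iff_ne_zero.2 (neg_ne_zero.2 hs)
  refine ⟨F * !![1, 0, -N, (l + c) * N; 0, 1, -(l + c), (l + c) ^ 2 - N; 0, 0, 1, -l; 0, 0, 0, 1],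
    ?_, ?_⟩
  · rw [det_mul]
    exact hdetF.mul (isUnit_det_unitriangular _ _ _ _ _ _)
  · rw [← Matrix.mul_assoc, hFL, Matrix.mul_assoc, hLR, Matrix.mul_assoc]

/-- Realization of the polynomial `(X - l) (X - c) (X² + (l + c) X + N)` by a Metzler upper
Hessenberg matrix with a positive left eigenvector for `l`. Depending on the signs of the
coefficients `k₃` and `k₄` this is the companion matrix itself, a `3`-cycle attached to the fixed
eigenvalue `c`, or a cycle through all four indices added to a matrix with real eigenvalues.
The columns of the unitriangular matrices `R` in the proof are the coefficients of the
characteristic polynomials of the leading principal blocks of `H`, and the entries of `z` are the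
values of these polynomials at `l`. -/
lemma exists_hessenberg_similar_companionFour {l c N : ℝ} (hcl : c < l) (hl : 0 ≤ 3 * l + c)
    (hN : (l + c) ^ 2 < 4 * N) (h2 : l * c - (l + c) ^ 2 + N ≤ 0)
    (hF1 : 0 < c → 4 * c ^ 2 ≤ -6 * (l * c - (l + c) ^ 2 + N))
    (hF2 : 0 ≤ (l + c) * (l * c - N) →
      27 * ((l + c) * (l * c - N)) ^ 2 ≤ -8 * (l * c - (l + c) ^ 2 + N) ^ 3) :
    ∃ (R H : Matrix (Fin 4) (Fin 4) ℝ) (z : Fin 4 → ℝ), IsUnit R.det ∧ H.IsMetzler ∧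
      H.IsUpperHessenberg ∧ (∀ i, 0 < z i) ∧ z ᵥ* H = l • z ∧
      companionFour (l * c - (l + c) ^ 2 + N) ((l + c) * (l * c - N)) (l * c * N) * R = R * H := by
  have hl0 : 0 < l := by linarith
  have hN0 : 0 < N := by nlinarith [sq_nonneg (l + c)]
  have hQ : ∀ x, 0 < x ^ 2 + (l + c) * x + N := fun x => by
    nlinarith [sq_nonneg (2 * x + (l + c))]
  rcases lt_or_ge 0 (l * c * N) with h4 | h4
  · have hc : 0 < c := by
      have := pos_of_mul_pos_left h4 hN0.le
      exact pos_of_mul_pos_right this hl0.le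
    -- the `3`-cycle realizes the cubic `(X - l) Q` expanded at the mean `-c / 3` of its roots
    obtain ⟨m, hm⟩ : ∃ m, m = -c / 3 := ⟨_, rfl⟩
    have hcm : c = -3 * m := by linarith
    obtain ⟨b, hb⟩ : ∃ b, b = l * c - (l + c) ^ 2 + N + 2 * c ^ 2 / 3 := ⟨_, rfl⟩
    obtain ⟨d, hd⟩ : ∃ d, d = (m - l) * (m ^ 2 + (l + c) * m + N) := ⟨_, rfl⟩
    have hb0 : b ≤ 0 := by linarith [hF1 hc]
    have hd0 : d ≤ 0 := by
      rw [hd]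
      exact mul_nonpos_of_nonpos_of_nonneg (by linarith) (hQ m).le
    refine ⟨!![1, -c, c * m, -c * m ^ 2; 0, 1, -(c + m), m ^ 2 + 2 * c * m; 0, 0, 1, -(2 * m + c);
        0, 0, 0, 1], !![c, 0, 0, 0; 1, m, 0, -d; 0, 1, m, -b; 0, 0, 1, m],
      ![1, l - c, (l - c) * (l - m), (l - c) * (l - m) ^ 2],
      isUnit_det_unitriangular _ _ _ _ _ _, ?_, ?_, ?_, ?_, ?_⟩
    · intro i j
      fin_cases i <;> fin_cases j <;> simp <;> linarith
    · intro i j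
      fin_cases i <;> fin_cases j <;> simp
    · have h5 : 0 < l - c := by linarith
      have h6 : 0 < l - m := by linarith
      intro i
      fin_cases i
      exacts [one_pos, h5, mul_pos h5 h6, mul_pos h5 (pow_pos h6 2)]
    · subst hb hd hcm
      ext j
      fin_cases j <;> simp [vecMul, dotProduct, Fin.sum_univ_four] <;> ring
    · subst hb hd hcm
      ext i j
      fin_cases i <;> fin_cases j <;> simp [companionFour, mul_apply, Fin.sum_univ_four] <;> ring
  rcases le_or_gt ((l + c) * (l * c - N)) 0 with h3 | h3
  · refine ⟨1, companionFour _ _ _, ![1, l, l ^ 2, l ^ 3], by simp, ?_, ?_, ?_, ?_,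
      by rw [mul_one, one_mul]⟩
    · intro i j
      fin_cases i <;> fin_cases j <;> simp [companionFour] <;> linarith
    · intro i j
      fin_cases i <;> fin_cases j <;> simp [companionFour]
    · intro i
      fin_cases i <;> simp <;> positivity
    · ext j
      fin_cases j <;> simp [companionFour, vecMul, dotProduct, Fin.sum_univ_four] <;> ring
  · set k₂ := l * c - (l + c) ^ 2 + N with hk₂
    set k₃ := (l + c) * (l * c - N) with hk₃
    have hc : l + c < 0 := by
      have : l * c - N < 0 := by nlinarith [sq_nonneg (l - c)]
      by_contra! h
      nlinarith
    -- a critical point `m` of the polynomial, between `0` and `√(-k₂ / 6)`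
    obtain ⟨m, hm0, hm2, hm⟩ : ∃ m : ℝ, 0 ≤ m ∧ 6 * m ^ 2 ≤ -k₂ ∧
        4 * m ^ 3 + 2 * k₂ * m + k₃ = 0 := by
      set κ := √(-k₂ / 6) with hκ
      have hκ0 : 0 ≤ κ := Real.sqrt_nonneg _
      have hκ2 : k₂ = -6 * κ ^ 2 := by
        rw [hκ, Real.sq_sqrt (by linarith)]
        ring
      have hk : k₃ ≤ 8 * κ ^ 3 := by
        refine (abs_le_of_sq_le_sq' ?_ (by positivity)).2
        have := hF2 h3.le
        rw [hκ2] at this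
        linarith
      have hcont : ContinuousOn (fun m : ℝ => 4 * m ^ 3 + 2 * k₂ * m + k₃) (Set.Icc 0 κ) := by
        fun_prop
      have h0 : (0 : ℝ) ∈ Set.Icc (4 * κ ^ 3 + 2 * k₂ * κ + k₃) (4 * 0 ^ 3 + 2 * k₂ * 0 + k₃) := by
        rw [hκ2]
        constructor <;> linarith
      obtain ⟨m, ⟨hm0, hmκ⟩, hm⟩ := intermediate_value_Icc' hκ0 hcont h0
      refine ⟨m, hm0, ?_, hm⟩
      have := pow_le_pow_left₀ hm0 hmκ 2
      linarith
    -- the polynomial has no critical point to the right of `l`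
    have hml : m < l := by
      by_contra! h
      have e : 4 * m ^ 3 + 2 * k₂ * m + k₃ = (2 * m - (l + c)) * (m ^ 2 + (l + c) * m + N)
          + (m - l) * (m - c) * (2 * m + (l + c)) := by
        rw [hk₂, hk₃]
        ring
      have h5 : 0 < (2 * m - (l + c)) * (m ^ 2 + (l + c) * m + N) :=
        mul_pos (by linarith) (hQ m)
      have h6 : 0 ≤ (m - l) * (m - c) * (2 * m + (l + c)) :=
        mul_nonneg (mul_nonneg (by linarith) (by linarith)) (by linarith)
      linarith
    have hpm : (m - l) * (m - c) * (m ^ 2 + (l + c) * m + N) ≤ 0 :=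
      mul_nonpos_of_nonpos_of_nonneg
        (mul_nonpos_of_nonpos_of_nonneg (by linarith) (by linarith)) (hQ m).le
    have hm' : (2 * m - (l + c)) * (m ^ 2 + (l + c) * m + N)
        + (m - l) * (m - c) * (2 * m + (l + c)) = 0 := by
      rw [← hm, hk₂, hk₃]
      ring
    refine ⟨!![1, -m, m ^ 2, m ^ 3; 0, 1, -2 * m, -m ^ 2; 0, 0, 1, -m; 0, 0, 0, 1],
      !![m, 0, 0, -((m - l) * (m - c) * (m ^ 2 + (l + c) * m + N)); 1, m, 0, 0;
        0, 1, -m, -k₂ - 2 * m ^ 2; 0, 0, 1, -m],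
      ![1, l - m, (l - m) ^ 2, (l - m) ^ 2 * (l + m)],
      isUnit_det_unitriangular _ _ _ _ _ _, ?_, ?_, ?_, ?_, ?_⟩
    · intro i j
      fin_cases i <;> fin_cases j <;> simp <;> nlinarith
    · intro i j
      fin_cases i <;> fin_cases j <;> simp
    · have h6 : 0 < l - m := by linarith
      intro i
      fin_cases i
      exacts [one_pos, h6, pow_pos h6 2, mul_pos (pow_pos h6 2) (by linarith)]
    · ext j
      fin_cases j <;> simp [vecMul, dotProduct, Fin.sum_univ_four, hk₂]
      · ring
      · ring
      · linear_combination (l - m) * hm'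
    · ext i j
      fin_cases i <;> fin_cases j <;> simp [companionFour, mul_apply, Fin.sum_univ_four]
      all_goals first
        | ring1
        | linear_combination m * hm' + m ^ 2 * hk₂
        | linear_combination -hm

/-! ### Irreducible matrices -/

lemma trace_eq_of_mul_eq_mul {n : ℕ} {A S M : Matrix (Fin n) (Fin n) ℝ} (hS : IsUnit S.det)
    (h : A * S = S * M) : A.trace = M.trace := by
  have : A = S * M * S⁻¹ := by rw [← h, mul_nonsing_inv_cancel_right _ _ hS]
  rw [this, trace_mul_comm, nonsing_inv_mul_cancel_left _ _ hS]

lemma blockUpper_blockUpper_fin_two (l c : ℝ) (r : Fin 3 → ℝ) (r' : Fin 2 → ℝ)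
    (D : Matrix (Fin 2) (Fin 2) ℝ) : blockUpper l r (blockUpper c r' D) =
      !![l, r 0, r 1, r 2; 0, c, r' 0, r' 1; 0, 0, D 0 0, D 0 1; 0, 0, D 1 0, D 1 1] := by
  ext i j
  fin_cases i <;> fin_cases j <;> rfl

/-- The case of a pair of nonreal eigenvalues, those of the lower right `2 × 2` block `D`. -/
lemma HasMetzlerHessenberg.of_nonreal {A S : Matrix (Fin 4) (Fin 4) ℝ} (hM : A.IsMetzler)
    (htr : A.trace = 0) {v : Fin 4 → ℝ} (hv : ∀ i, 0 < v i) {l c : ℝ}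
    (hAv : A *ᵥ v = l • v) (hcl : c < l) {y : Fin 4 → ℝ} (hy0 : y ≠ 0) (hyv : y ⬝ᵥ v = 0)
    (hy : y ᵥ* A = c • y) {r : Fin 3 → ℝ} {r' : Fin 2 → ℝ} {D : Matrix (Fin 2) (Fin 2) ℝ}
    (hS : IsUnit S.det) (h : A * S = S * blockUpper l r (blockUpper c r' D))
    (hdisc : (D 0 0 - D 1 1) ^ 2 + 4 * (D 0 1 * D 1 0) < 0) : A.HasMetzlerHessenberg := by
  rw [blockUpper_blockUpper_fin_two] at h
  generalize D 0 0 = p at *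
  generalize D 0 1 = q at *
  generalize D 1 0 = s at *
  generalize D 1 1 = t at *
  generalize r 0 = m₁ at *
  generalize r 1 = m₂ at *
  generalize r 2 = m₃ at *
  generalize r' 0 = m₄ at *
  generalize r' 1 = m₅ at *
  set M : Matrix (Fin 4) (Fin 4) ℝ := !![l, m₁, m₂, m₃; 0, c, m₄, m₅; 0, 0, p, q; 0, 0, s, t]
    with hMdef
  have htr1 : l + c + p + t = 0 := by
    have := trace_eq_of_mul_eq_mul hS h
    rw [htr] at this
    simp [hMdef, trace, Fin.sum_univ_four] at this
    linarith
  have h2 : A * A * S = S * (M * M) := by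
    rw [Matrix.mul_assoc, h, ← Matrix.mul_assoc, h, Matrix.mul_assoc]
  have h3 : A * A * A * S = S * (M * M * M) := by
    rw [Matrix.mul_assoc, h, ← Matrix.mul_assoc, h2, Matrix.mul_assoc]
  have htr2 : (A * A).trace = l ^ 2 + c ^ 2 + p ^ 2 + t ^ 2 + 2 * (q * s) := by
    rw [trace_eq_of_mul_eq_mul hS h2]
    simp [hMdef, trace, Fin.sum_univ_four]
    ring
  have htr3 : (A * A * A).trace = l ^ 3 + c ^ 3 + p ^ 3 + t ^ 3 + 3 * (q * s) * (p + t) := by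
    rw [trace_eq_of_mul_eq_mul hS h3]
    simp [hMdef, trace, Fin.sum_univ_four]
    ring
  -- the real part of the nonreal eigenvalues is at most `l`
  have ha : (p + t) / 2 ≤ l := by
    set b := √(-((p - t) ^ 2 + 4 * (q * s))) / 2 with hb
    have hb0 : b ≠ 0 := by
      have : 0 < √(-((p - t) ^ 2 + 4 * (q * s))) := Real.sqrt_pos.2 (by linarith)
      positivity
    have hb2 : b * b = -((p - t) ^ 2 + 4 * (q * s)) / 4 := by
      have := Real.mul_self_sqrt (by linarith : 0 ≤ -((p - t) ^ 2 + 4 * (q * s)))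
      rw [hb]
      linarith
    have hSA : S⁻¹ * A = M * S⁻¹ := by
      have := congrArg (fun X => S⁻¹ * X * S⁻¹) h
      simpa [Matrix.mul_assoc, mul_nonsing_inv _ hS, nonsing_inv_mul_cancel_left _ _ hS] using this
    set w₁ : Fin 4 → ℝ := ![0, 0, 0, 1] with hw₁
    set w₂ : Fin 4 → ℝ := ![0, 0, -s / b, (p - t) / (2 * b)] with hw₂
    refine le_of_vecMul_eq_of_vecMul_eq hM hv hAv (y₁ := w₁ ᵥ* S⁻¹) (y₂ := w₂ ᵥ* S⁻¹) (b := b)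
      ?_ ?_ ?_
    · intro h0
      have : w₁ = 0 := by
        have := congrArg (fun x => x ᵥ* S) h0
        simpa [vecMul_vecMul, nonsing_inv_mul _ hS] using this
      have := congrFun this 3
      simp [hw₁] at this
    · rw [vecMul_vecMul, hSA, ← vecMul_vecMul, ← smul_vecMul, ← smul_vecMul, ← sub_vecMul]
      congr 1
      ext j
      fin_cases j <;> simp [hw₁, hw₂, hMdef, vecMul, dotProduct, Fin.sum_univ_four]
      · field_simp
      · field_simp
        ring
    · rw [vecMul_vecMul, hSA, ← vecMul_vecMul, ← smul_vecMul, ← smul_vecMul, ← add_vecMul]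
      congr 1
      ext j
      fin_cases j <;> simp [hw₁, hw₂, hMdef, vecMul, dotProduct, Fin.sum_univ_four]
      · field_simp
        ring
      · field_simp
        rw [sq, hb2]
        ring
  obtain ⟨F, hF, hFM⟩ := exists_similar_companionFour (m₁ := m₁) (m₂ := m₂) (m₃ := m₃) (m₄ := m₄)
    (m₅ := m₅) htr1 hcl.ne' hdisc
  rw [← hMdef] at hFM
  have ht : t = -(l + c) - p := by linarith
  set N := p * t - q * s with hN
  have k2 : (A * A).trace = -2 * (l * c - (l + c) ^ 2 + N) := by
    rw [htr2, hN, ht]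
    ring
  have k3 : (A * A * A).trace = -3 * ((l + c) * (l * c - N)) := by
    rw [htr3, hN, ht]
    ring
  obtain ⟨R, H, z, hR, hHM, hHH, hz, hzH, hRH⟩ := exists_hessenberg_similar_companionFour (N := N)
    hcl (by linarith) (by rw [show l + c = -(p + t) by linarith, hN]; nlinarith)
    (by have := trace_mul_self_nonneg_of_isMetzler hM htr; linarith)
    (fun hc => by
      have hpos := exists_pos_of_dotProduct_eq_zero hv hy0 hyv
      have hneg := exists_pos_of_dotProduct_eq_zero (y := -y) hv (neg_ne_zero.2 hy0) (by simp [hyv])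
      have := four_mul_sq_le_three_mul_trace hM htr hc hy hpos (by simpa using hneg)
      linarith)
    (fun h => by
      have := three_mul_trace_cube_sq_le hM htr (by linarith)
      rw [k2, k3] at this
      linarith)
  refine HasMetzlerHessenberg.of_similar (S := S * F * R) (H := H) hv hAv hz hzH ?_ ?_ hHM hHH
  · rw [det_mul, det_mul]
    exact (hS.mul hF).mul hR
  · rw [← Matrix.mul_assoc, ← Matrix.mul_assoc, h, Matrix.mul_assoc S, hFM,
      Matrix.mul_assoc (S * F), ← hRH]
    simp only [Matrix.mul_assoc]

lemma HasMetzlerHessenberg.of_isIndecomposable {A : Matrix (Fin 4) (Fin 4) ℝ} (hM : A.IsMetzler)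
    (htr : A.trace = 0) (hA : A.IsIndecomposable) : A.HasMetzlerHessenberg := by
  obtain ⟨l, v, hv, hAv⟩ := hA.exists_pos_eigenvector hM
  have hv0 : v ≠ 0 := fun h => by simpa [h] using hv 0
  obtain ⟨S, r, B, hS, hcol, h⟩ := exists_deflation hv0 hAv
  obtain ⟨c, hc⟩ := exists_det_sub_smul_one_eq_zero B
  obtain ⟨x, hx0, hx⟩ := exists_mulVec_eq_smul hc
  obtain ⟨R, r', D, hR, -, hRD⟩ := exists_deflation hx0 hx
  have hlt : ∀ μ : ℝ, (B - μ • 1).det = 0 → μ < l := by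
    intro μ hμ
    obtain ⟨y, hy0, hyv, hy⟩ := exists_vecMul_eq_of_deflation hS hcol h hμ
    exact hA.lt_of_vecMul_eq hM hv hAv hy0 hyv hy
  rcases lt_or_ge ((D 0 0 - D 1 1) ^ 2 + 4 * (D 0 1 * D 1 0)) 0 with hdisc | hdisc
  · obtain ⟨y, hy0, hyv, hy⟩ := exists_vecMul_eq_of_deflation hS hcol h hc
    obtain ⟨S', hS', -, h'⟩ := deflation_trans hS h hR hRD
    exact .of_nonreal hM htr hv hAv (hlt c hc) hy0 hyv hy hS' h' hdisc
  · obtain ⟨d, hd⟩ : ∃ d : ℝ, (D - d • 1).det = 0 := by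
      refine ⟨(D 0 0 + D 1 1 + √((D 0 0 - D 1 1) ^ 2 + 4 * (D 0 1 * D 1 0))) / 2, ?_⟩
      rw [det_fin_two]
      have := Real.mul_self_sqrt hdisc
      simp
      linarith
    obtain ⟨x', hx'0, hx'⟩ := exists_mulVec_eq_smul hd
    obtain ⟨Q, r'', E, hQ, -, hQE⟩ := exists_deflation hx'0 hx'
    obtain ⟨R', hR', -, hRE⟩ := deflation_trans hR hRD hQ hQE
    have hU : blockUpper c (r' ᵥ* Q) (blockUpper d r'' E) =
        !![c, (r' ᵥ* Q) 0, (r' ᵥ* Q) 1; 0, d, r'' 0; 0, 0, E 0 0] := by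
      ext i j
      fin_cases i <;> fin_cases j <;> rfl
    rw [hU] at hRE
    obtain ⟨S', hS', hcol', h'⟩ := deflation_trans hS h hR' hRE
    -- the diagonal entries are eigenvalues of `B`
    have hdet : ∀ μ : ℝ, (c - μ) * (d - μ) * (E 0 0 - μ) = 0 → μ < l := by
      intro μ hμ
      apply hlt
      set U := !![c, (r' ᵥ* Q) 0, (r' ᵥ* Q) 1; 0, d, r'' 0; 0, 0, E 0 0]
      have e : (B - μ • 1) * R' = R' * (U - μ • 1) := by
        rw [sub_mul, hRE, mul_sub]
        simp
      have e2 : (U - μ • 1).det = 0 := by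
        rw [det_fin_three]
        simpa [U] using hμ
      have e3 := congrArg det e
      rw [det_mul, det_mul, e2, mul_zero] at e3
      exact (mul_eq_zero.1 e3).resolve_right hR'.ne_zero
    exact .of_upperTriangular hv hS' (fun i => by rw [hcol', hcol]) h'
      (hdet _ (by simp)) (hdet _ (by simp)) (hdet _ (by simp))

/-! ### Matrices of order three -/

/-- One of the two Hessenberg bases of a `3 × 3` matrix `B`: the vectors `e₀`, the off-diagonal part
`(0, p, q)` of `B e₀`, and `e₁`. -/
lemma exists_hessenberg_basis_one {B : Matrix (Fin 3) (Fin 3) ℝ} (hB : B.IsMetzler)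
    (hq : 0 < B 2 0)
    (h : B 1 0 * (B 1 0 * B 2 1 + B 2 0 * B 2 2) ≤ B 2 0 * (B 1 0 * B 1 1 + B 2 0 * B 1 2)) :
    ∃ T H : Matrix (Fin 3) (Fin 3) ℝ, T.IsNonneg ∧ IsUnit T.det ∧ H.IsMetzler ∧
      H.IsUpperHessenberg ∧ B * T = T * H ∧
      ∀ g : Fin 3 → ℝ, (∀ i, 0 ≤ g i) → B 1 0 * g 2 ≤ B 2 0 * g 1 →
        ∃ y : Fin 3 → ℝ, (∀ i, 0 ≤ y i) ∧ T *ᵥ y = g := by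
  have h01 := hB 0 1 (by decide)
  have h02 := hB 0 2 (by decide)
  have h10 := hB 1 0 (by decide)
  have h12 := hB 1 2 (by decide)
  have h21 := hB 2 1 (by decide)
  obtain ⟨p, hp⟩ : ∃ p, p = B 1 0 := ⟨_, rfl⟩
  obtain ⟨q, hq'⟩ : ∃ q, q = B 2 0 := ⟨_, rfl⟩
  rw [← hp, ← hq'] at h
  rw [← hp] at h10 ⊢
  rw [← hq'] at hq ⊢
  have hp00 : 0 ≤ p * B 0 1 + q * B 0 2 := by positivity
  have h32 : 0 ≤ (p * B 1 1 + q * B 1 2) - (p * B 2 1 + q * B 2 2) * p / q := by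
    rw [sub_nonneg, div_le_iff₀ hq]
    linarith
  refine ⟨!![1, 0, 0; 0, p, 1; 0, q, 0],
    !![B 0 0, p * B 0 1 + q * B 0 2, B 0 1; 1, (p * B 2 1 + q * B 2 2) / q, B 2 1 / q;
      0, (p * B 1 1 + q * B 1 2) - (p * B 2 1 + q * B 2 2) * p / q, B 1 1 - B 2 1 * p / q],
    ?_, ?_, ?_, ?_, ?_, ?_⟩
  · intro i j
    fin_cases i <;> fin_cases j <;> simp [h10, hq.le]
  · rw [det_fin_three]
    simp [hq.ne']
  · intro i j hij
    fin_cases i <;> fin_cases j <;> first | exact absurd rfl hij | skip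
    exacts [hp00, h01, zero_le_one, div_nonneg h21 hq.le, le_rfl, h32]
  · intro i j hij
    fin_cases i <;> fin_cases j <;> simp_all
  · ext i j
    fin_cases i <;> fin_cases j <;> simp [mul_apply, Fin.sum_univ_three, hp, hq'] <;>
      field_simp [← hq', hq.ne'] <;> ring
  · intro g hg hpq
    refine ⟨![g 0, g 2 / q, g 1 - p * g 2 / q], ?_, ?_⟩
    · have : 0 ≤ g 1 - p * g 2 / q := by
        rw [sub_nonneg, div_le_iff₀ hq]
        linarith
      intro i
      fin_cases i
      exacts [hg 0, div_nonneg (hg 2) hq.le, this]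
    · ext i
      fin_cases i <;> simp [mulVec, dotProduct, Fin.sum_univ_three]
      all_goals field_simp
      all_goals ring

/-- The basis of `exists_hessenberg_basis_one` with `e₂` in place of `e₁`. -/
lemma exists_hessenberg_basis_two {B : Matrix (Fin 3) (Fin 3) ℝ} (hB : B.IsMetzler)
    (hp : 0 < B 1 0)
    (h : B 2 0 * (B 1 0 * B 1 1 + B 2 0 * B 1 2) ≤ B 1 0 * (B 1 0 * B 2 1 + B 2 0 * B 2 2)) :
    ∃ T H : Matrix (Fin 3) (Fin 3) ℝ, T.IsNonneg ∧ IsUnit T.det ∧ H.IsMetzler ∧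
      H.IsUpperHessenberg ∧ B * T = T * H ∧
      ∀ g : Fin 3 → ℝ, (∀ i, 0 ≤ g i) → B 2 0 * g 1 ≤ B 1 0 * g 2 →
        ∃ y : Fin 3 → ℝ, (∀ i, 0 ≤ y i) ∧ T *ᵥ y = g := by
  let e : Equiv.Perm (Fin 3) := Equiv.swap 1 2
  have e0 : e 0 = 0 := by decide
  have e1 : e 1 = 2 := by decide
  have e2 : e 2 = 1 := by decide
  have ee : ∀ i, e (e i) = i := by decide
  obtain ⟨T, H, hT, hdet, hM, hH, hBT, hg⟩ := exists_hessenberg_basis_one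
    (B := B.submatrix e e) (fun i j hij => hB _ _ (e.injective.ne hij))
    (by simpa [e0, e2] using hp) (by simp only [submatrix_apply, e0, e1, e2]; linarith)
  refine ⟨T.submatrix e id, H, fun i j => hT _ _, ?_, hM, hH, ?_, fun g hg0 hpq => ?_⟩
  · rw [det_permute]
    exact ((Equiv.Perm.sign e).isUnit.map (Int.castRingHom ℝ)).mul hdet
  · ext i j
    have := congrFun (congrFun hBT (e i)) j
    simp only [mul_apply, submatrix_apply, ee, id] at this ⊢
    rw [← this]
    exact Fintype.sum_equiv e _ _ (fun k => by rw [ee])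
  · obtain ⟨y, hy, hTy⟩ := hg (g ∘ e) (fun i => hg0 _)
      (by simpa only [submatrix_apply, Function.comp, e0, e1, e2] using hpq)
    refine ⟨y, hy, ?_⟩
    ext i
    have := congrFun hTy (e i)
    simpa [mulVec, dotProduct, ee] using this

lemma HasMetzlerHessenberg.of_isMetzler_three {B : Matrix (Fin 3) (Fin 3) ℝ} (hB : B.IsMetzler) :
    B.HasMetzlerHessenberg := by
  rcases (hB 2 0 (by decide)).eq_or_lt with hq | hq
  · refine ⟨1, B, fun i j => ?_, by simp, hB, fun i j hij => ?_, by simp⟩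
    · rw [one_apply]
      split_ifs <;> norm_num
    · fin_cases i <;> fin_cases j <;> simp_all
  rcases le_or_gt (B 1 0 * (B 1 0 * B 2 1 + B 2 0 * B 2 2))
    (B 2 0 * (B 1 0 * B 1 1 + B 2 0 * B 1 2)) with h | h
  · obtain ⟨T, H, hT, hdet, hM, hH, hBT, -⟩ := exists_hessenberg_basis_one hB hq h
    exact ⟨T, H, hT, hdet, hM, hH, hBT⟩
  · have hp : 0 < B 1 0 := by
      refine lt_of_le_of_ne (hB 1 0 (by decide)) fun h0 => ?_
      rw [← h0] at h
      have := mul_nonneg hq.le (mul_nonneg hq.le (hB 1 2 (by decide)))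
      linarith
    obtain ⟨T, H, hT, hdet, hM, hH, hBT, -⟩ := exists_hessenberg_basis_two hB hp h.le
    exact ⟨T, H, hT, hdet, hM, hH, hBT⟩

/-- A `3 × 3` Metzler matrix with Perron vector `v` has a Hessenberg basis whose cone contains all
`K • v + g` with `K` large, for a prescribed nonnegative `g`. The invariant cones of the two
available bases are separated by a plane; the side on which `v` lies decides between them, and the
side of `g` if `v` lies on the plane. -/
lemma exists_hessenberg_basis_cone {B : Matrix (Fin 3) (Fin 3) ℝ} (hB : B.IsMetzler)
    {v : Fin 3 → ℝ} (hv : ∀ i, 0 < v i) {r : ℝ} (hBv : B *ᵥ v = r • v) {g : Fin 3 → ℝ}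
    (hg : ∀ i, 0 ≤ g i) :
    ∃ T H : Matrix (Fin 3) (Fin 3) ℝ, T.IsNonneg ∧ IsUnit T.det ∧ H.IsMetzler ∧
      H.IsUpperHessenberg ∧ B * T = T * H ∧ ∃ K₀ : ℝ, ∀ K ≥ K₀,
        ∃ y : Fin 3 → ℝ, (∀ i, 0 ≤ y i) ∧ T *ᵥ y = K • v + g := by
  have hKg : ∀ K : ℝ, 0 ≤ K → ∀ i, 0 ≤ (K • v + g) i := fun K hK i =>
    add_nonneg (mul_nonneg hK (hv i).le) (hg i)
  rcases (hB 2 0 (by decide)).eq_or_lt with hq | hq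
  · refine ⟨1, B, fun i j => ?_, by simp, hB, fun i j hij => ?_, by simp, 0, fun K hK =>
      ⟨K • v + g, hKg K hK, by simp⟩⟩
    · rw [one_apply]
      split_ifs <;> norm_num
    · fin_cases i <;> fin_cases j <;> simp_all
  have hp := hB 1 0 (by decide)
  have h12 := hB 1 2 (by decide)
  have h21 := hB 2 1 (by decide)
  have e1 : B 1 0 * v 0 + B 1 1 * v 1 + B 1 2 * v 2 = r * v 1 := by
    simpa [mulVec, dotProduct, Fin.sum_univ_three] using congrFun hBv 1
  have e2 : B 2 0 * v 0 + B 2 1 * v 1 + B 2 2 * v 2 = r * v 2 := by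
    simpa [mulVec, dotProduct, Fin.sum_univ_three] using congrFun hBv 2
  have hv0 := hv 0
  have hv1 := hv 1
  have hv2 := hv 2
  have hr1 : 0 ≤ r - B 1 1 := by
    have : 0 ≤ (r - B 1 1) * v 1 := by
      have := mul_nonneg hp hv0.le
      have := mul_nonneg h12 hv2.le
      linarith
    exact nonneg_of_mul_nonneg_left this hv1
  have hr2 : 0 ≤ r - B 2 2 := by
    have : 0 ≤ (r - B 2 2) * v 2 := by
      have := mul_nonneg hq.le hv0.le
      have := mul_nonneg h21 hv1.le
      linarith
    exact nonneg_of_mul_nonneg_left this hv2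
  set φ := B 2 0 * v 1 - B 1 0 * v 2 with hφ
  set D := B 2 0 * (B 1 0 * B 1 1 + B 2 0 * B 1 2) - B 1 0 * (B 1 0 * B 2 1 + B 2 0 * B 2 2) with hD
  have hD2 : v 2 * D = φ * (B 2 0 * (r - B 1 1) + B 1 0 * B 2 1) := by
    linear_combination (B 2 0) * ((B 2 0) * e1 - (B 1 0) * e2)
  have hD1 : v 1 * D = φ * (B 1 0 * (r - B 2 2) + B 2 0 * B 1 2) := by
    linear_combination (B 1 0) * ((B 2 0) * e1 - (B 1 0) * e2)
  -- the first basis, under the conditions that it applies and that its cone contains `K • v + g`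
  have one : 0 ≤ D → (∃ K₀, ∀ K ≥ K₀, 0 ≤ K * φ + (B 2 0 * g 1 - B 1 0 * g 2)) →
      ∃ T H : Matrix (Fin 3) (Fin 3) ℝ, T.IsNonneg ∧ IsUnit T.det ∧ H.IsMetzler ∧
      H.IsUpperHessenberg ∧ B * T = T * H ∧ ∃ K₀ : ℝ, ∀ K ≥ K₀,
        ∃ y : Fin 3 → ℝ, (∀ i, 0 ≤ y i) ∧ T *ᵥ y = K • v + g := by
    rintro h ⟨K₀, hK₀⟩
    obtain ⟨T, H, hT, hdet, hM, hH, hBT, hy⟩ := exists_hessenberg_basis_one hB hq (by linarith)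
    refine ⟨T, H, hT, hdet, hM, hH, hBT, max K₀ 0, fun K hK => ?_⟩
    refine hy _ (hKg K ((le_max_right _ _).trans hK)) ?_
    have := hK₀ K ((le_max_left _ _).trans hK)
    simp only [Pi.add_apply, Pi.smul_apply, smul_eq_mul]
    linarith
  have two : 0 < B 1 0 → D ≤ 0 → (∃ K₀, ∀ K ≥ K₀, 0 ≤ K * -φ - (B 2 0 * g 1 - B 1 0 * g 2)) →
      ∃ T H : Matrix (Fin 3) (Fin 3) ℝ, T.IsNonneg ∧ IsUnit T.det ∧ H.IsMetzler ∧
      H.IsUpperHessenberg ∧ B * T = T * H ∧ ∃ K₀ : ℝ, ∀ K ≥ K₀,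
        ∃ y : Fin 3 → ℝ, (∀ i, 0 ≤ y i) ∧ T *ᵥ y = K • v + g := by
    rintro hp h ⟨K₀, hK₀⟩
    obtain ⟨T, H, hT, hdet, hM, hH, hBT, hy⟩ := exists_hessenberg_basis_two hB hp (by linarith)
    refine ⟨T, H, hT, hdet, hM, hH, hBT, max K₀ 0, fun K hK => ?_⟩
    refine hy _ (hKg K ((le_max_right _ _).trans hK)) ?_
    have := hK₀ K ((le_max_left _ _).trans hK)
    simp only [Pi.add_apply, Pi.smul_apply, smul_eq_mul]
    linarith
  rcases lt_trichotomy φ 0 with h | h | h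
  · refine two (lt_of_le_of_ne hp fun h0 => ?_) ?_ ?_
    · rw [← h0, zero_mul, sub_zero] at hφ
      have := mul_pos hq hv1
      linarith
    · have : v 1 * D ≤ 0 := by
        rw [hD1]
        exact mul_nonpos_of_nonpos_of_nonneg h.le
          (add_nonneg (mul_nonneg hp hr2) (mul_nonneg hq.le h12))
      exact nonpos_of_mul_nonpos_right this hv1
    · obtain ⟨K₀, hK₀⟩ := exists_forall_ge_of_finite (ι := Unit)
        (fun _ => -(B 2 0 * g 1 - B 1 0 * g 2)) (fun _ => -φ) (fun _ => neg_pos.2 h)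
      exact ⟨K₀, fun K hK => by linarith [hK₀ K hK ()]⟩
  · have hD0 : D = 0 := by
      rw [h, zero_mul] at hD2
      exact (mul_eq_zero.1 hD2).resolve_left hv2.ne'
    rcases le_total 0 (B 2 0 * g 1 - B 1 0 * g 2) with h' | h'
    · exact one hD0.ge ⟨0, fun K _ => by rw [h]; linarith⟩
    · refine two (lt_of_le_of_ne hp fun h0 => ?_) hD0.le ⟨0, fun K _ => by rw [h]; linarith⟩
      rw [← h0, zero_mul, sub_zero] at hφ
      have := mul_pos hq hv1
      linarith
  · refine one ?_ ?_
    · have : 0 ≤ v 2 * D := by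
        rw [hD2]
        exact mul_nonneg h.le (add_nonneg (mul_nonneg hq.le hr1) (mul_nonneg hp h21))
      exact nonneg_of_mul_nonneg_right this hv2
    · obtain ⟨K₀, hK₀⟩ := exists_forall_ge_of_finite (ι := Unit)
        (fun _ => B 2 0 * g 1 - B 1 0 * g 2) (fun _ => φ) (fun _ => h)
      exact ⟨K₀, fun K hK => by linarith [hK₀ K hK ()]⟩

/-! ### Extending a Hessenberg basis by one vector -/

section

/-- The block upper triangular matrix with upper left block `P`, remaining last column `x` and
corner `a`. -/
def blockUpperLast {n : ℕ} (P : Matrix (Fin n) (Fin n) ℝ) (x : Fin n → ℝ) (a : ℝ) :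
    Matrix (Fin (n + 1)) (Fin (n + 1)) ℝ :=
  of (Fin.snoc (α := fun _ => Fin (n + 1) → ℝ)
    (fun i => Fin.snoc (α := fun _ => ℝ) (P i) (x i)) (Fin.snoc (α := fun _ => ℝ) 0 a))

section blockUpperLast

variable {n : ℕ} (P : Matrix (Fin n) (Fin n) ℝ) (x : Fin n → ℝ) (a : ℝ)

@[simp] lemma blockUpperLast_castSucc_castSucc (i j : Fin n) :
    blockUpperLast P x a i.castSucc j.castSucc = P i j := by
  simp [blockUpperLast]

@[simp] lemma blockUpperLast_castSucc_last (i : Fin n) :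
    blockUpperLast P x a i.castSucc (Fin.last n) = x i := by
  simp [blockUpperLast]

@[simp] lemma blockUpperLast_last_castSucc (j : Fin n) :
    blockUpperLast P x a (Fin.last n) j.castSucc = 0 := by
  simp [blockUpperLast]

@[simp] lemma blockUpperLast_last_last : blockUpperLast P x a (Fin.last n) (Fin.last n) = a := by
  simp [blockUpperLast]

lemma det_blockUpperLast : (blockUpperLast P x a).det = a * P.det := by
  rw [det_succ_row _ (Fin.last n), Fin.sum_univ_castSucc]
  have : (blockUpperLast P x a).submatrix Fin.castSucc Fin.castSucc = P := by
    ext i j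
    simp
  simp [this, ← two_mul]

end blockUpperLast

/-- Extension of a Hessenberg basis of the upper left block by one vector `(x, 1)`. -/
lemma HasMetzlerHessenberg.of_last_row_eq_zero {n : ℕ} {A : Matrix (Fin (n + 1)) (Fin (n + 1)) ℝ}
    (hA : ∀ j : Fin n, A (Fin.last n) j.castSucc = 0) {T H : Matrix (Fin n) (Fin n) ℝ}
    (hT : T.IsNonneg) (hdet : IsUnit T.det) (hM : H.IsMetzler) (hH : H.IsUpperHessenberg)
    (h : A.submatrix Fin.castSucc Fin.castSucc * T = T * H) {x y : Fin n → ℝ}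
    (hx : ∀ i, 0 ≤ x i) (hy : ∀ i, 0 ≤ y i)
    (hxy : A.submatrix Fin.castSucc Fin.castSucc *ᵥ x + (fun i => A i.castSucc (Fin.last n)) =
      A (Fin.last n) (Fin.last n) • x + T *ᵥ y) : A.HasMetzlerHessenberg := by
  refine ⟨blockUpperLast T x 1, blockUpperLast H y (A (Fin.last n) (Fin.last n)),
    ?_, ?_, ?_, ?_, ?_⟩
  · intro i j
    refine Fin.lastCases ?_ (fun i => ?_) i <;> refine Fin.lastCases ?_ (fun j => ?_) j
    · simp
    · simp
    · simpa using hx i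
    · simpa using hT i j
  · rw [det_blockUpperLast, one_mul]
    exact hdet
  · intro i j
    refine Fin.lastCases ?_ (fun i => ?_) i <;> refine Fin.lastCases ?_ (fun j => ?_) j
    · intro h
      exact absurd rfl h
    · simp
    · simpa using hy i
    · intro hij
      simpa using hM i j (fun h => hij (by rw [h]))
  · intro i j
    refine Fin.lastCases ?_ (fun i => ?_) i <;> refine Fin.lastCases ?_ (fun j => ?_) j
    · intro hij
      omega
    · simp
    · intro hij
      simp only [Fin.val_last, Fin.val_castSucc] at hij
      omega
    · intro hij
      simpa using hH i j (by simpa using hij)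
  · ext i j
    refine Fin.lastCases ?_ (fun i => ?_) i <;> refine Fin.lastCases ?_ (fun j => ?_) j
    · simp [mul_apply, Fin.sum_univ_castSucc, hA]
    · simp [mul_apply, Fin.sum_univ_castSucc, hA]
    · have := congrFun hxy i
      simp only [mulVec, dotProduct, Pi.add_apply, Pi.smul_apply, smul_eq_mul,
        submatrix_apply] at this
      simp [mul_apply, Fin.sum_univ_castSucc]
      linarith
    · have := congrFun (congrFun h i) j
      simpa [mul_apply, Fin.sum_univ_castSucc] using this

variable {n : Type*} [Fintype n] [Nonempty n]

/-- Adding the multiple of the positive vector `v` that makes `x` just nonnegative produces a zero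
coordinate, in which a Metzler matrix cannot point outwards. -/
lemma exists_shift {B : Matrix n n ℝ} (hB : ∀ i j, i ≠ j → 0 ≤ B i j) {v : n → ℝ}
    (hv : ∀ i, 0 < v i) {r : ℝ} (hBv : B *ᵥ v = r • v) (x : n → ℝ) :
    ∃ (t : ℝ) (i : n), (∀ j, 0 ≤ x j + t * v j) ∧ x i + t * v i = 0 ∧
      0 ≤ (B *ᵥ x) i + t * (r * v i) := by
  obtain ⟨i, hi⟩ := Finite.exists_max fun j => -x j / v j
  have hnn : ∀ j, 0 ≤ x j + -x i / v i * v j := by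
    intro j
    have := hi j
    rw [div_le_iff₀ (hv j)] at this
    linarith
  have hz : x i + -x i / v i * v i = 0 := by
    rw [div_mul_cancel₀ _ (hv i).ne']
    ring
  refine ⟨-x i / v i, i, hnn, hz, ?_⟩
  generalize -x i / v i = t at hnn hz
  have e : (B *ᵥ x) i + t * (r * v i) = ∑ j, B i j * (x j + t * v j) := by
    have h1 : ∑ j, B i j * v j = r * v i := by
      simpa [mulVec, dotProduct] using congrFun hBv i
    simp only [mulVec, dotProduct, mul_add, sum_add_distrib]
    rw [← h1, mul_sum]
    congr 1
    exact sum_congr rfl fun j _ => by ring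
  rw [e]
  refine sum_nonneg fun j _ => ?_
  rcases eq_or_ne i j with rfl | hij
  · rw [hz, mul_zero]
  · exact mul_nonneg (hB i j hij) (hnn j)

/-- Above the Perron eigenvalue the resolvent is nonnegative. -/
lemma exists_nonneg_solution_of_lt [DecidableEq n] {B : Matrix n n ℝ}
    (hB : ∀ i j, i ≠ j → 0 ≤ B i j) {v : n → ℝ} (hv : ∀ i, 0 < v i) {r : ℝ}
    (hBv : B *ᵥ v = r • v) {d : ℝ} (hd : r < d) {g : n → ℝ}
    (hg : ∀ i, 0 ≤ g i) : ∃ x : n → ℝ, (∀ i, 0 ≤ x i) ∧ B *ᵥ x + g = d • x := by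
  have key : ∀ (g x : n → ℝ), (∀ i, 0 ≤ g i) → B *ᵥ x + g = d • x → ∀ i, 0 ≤ x i := by
    intro g x hg hx j
    obtain ⟨t, i, hnn, hz, h⟩ := exists_shift hB hv hBv x
    have h1 : (B *ᵥ x) i + g i = d * x i := by simpa using congrFun hx i
    have h2 : 0 ≤ -t * ((d - r) * v i) := by
      have := hg i
      have h3 : d * (x i + t * v i) = 0 := by rw [hz, mul_zero]
      linarith
    have ht : t ≤ 0 := by
      have := nonneg_of_mul_nonneg_left h2 (mul_pos (sub_pos.2 hd) (hv i))
      linarith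
    have := mul_nonpos_of_nonpos_of_nonneg ht (hv j).le
    linarith [hnn j]
  have hdet : IsUnit (B - d • 1).det := by
    rw [isUnit_iff_ne_zero]
    intro h0
    obtain ⟨x, hx0, hx⟩ := exists_mulVec_eq_zero_iff.2 h0
    rw [sub_mulVec, smul_mulVec, one_mulVec, sub_eq_zero] at hx
    apply hx0
    ext j
    have h1 := key 0 x (fun _ => le_rfl) (by rw [add_zero, hx]) j
    have h2 := key 0 (-x) (fun _ => le_rfl) (by rw [add_zero, mulVec_neg, hx, smul_neg]) j
    simp only [Pi.neg_apply] at h2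
    exact le_antisymm (neg_nonneg.1 h2) h1
  have e : B *ᵥ ((B - d • 1)⁻¹ *ᵥ -g) + g = d • ((B - d • 1)⁻¹ *ᵥ -g) := by
    have : (B - d • 1) *ᵥ ((B - d • 1)⁻¹ *ᵥ -g) = -g := by
      rw [mulVec_mulVec, mul_nonsing_inv _ hdet, one_mulVec]
    rw [sub_mulVec, smul_mulVec, one_mulVec] at this
    rw [sub_eq_iff_eq_add.1 this]
    abel
  exact ⟨_, key g _ hg e, e⟩

/-- At the Perron eigenvalue `r` the equation `(r - B) x = g` is solvable modulo the Perron vector,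
since that vector does not lie in the range of `B - r`. -/
lemma IsIndecomposable.exists_nonneg_solution [DecidableEq n] {B : Matrix n n ℝ}
    (hA : B.IsIndecomposable)
    (hB : ∀ i j, i ≠ j → 0 ≤ B i j) {v : n → ℝ}
    (hv : ∀ i, 0 < v i) {r : ℝ} (hBv : B *ᵥ v = r • v) {g : n → ℝ}
    (hg : ∀ i, 0 ≤ g i) :
    ∃ (x : n → ℝ) (a : ℝ), (∀ i, 0 ≤ x i) ∧ 0 ≤ a ∧ B *ᵥ x + g = r • x + a • v := by
  have key : ∀ (g x : n → ℝ) (a : ℝ), (∀ i, 0 ≤ g i) → B *ᵥ x + g = r • x + a • v → 0 ≤ a := by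
    intro g x a hg hx
    obtain ⟨t, i, -, hz, h⟩ := exists_shift hB hv hBv x
    have h1 : (B *ᵥ x) i + g i = r * x i + a * v i := by simpa using congrFun hx i
    have h2 : 0 ≤ a * v i := by
      have := hg i
      have h3 : r * (x i + t * v i) = 0 := by rw [hz, mul_zero]
      linarith
    exact nonneg_of_mul_nonneg_left h2 (hv i)
  obtain ⟨k⟩ := ‹Nonempty n›
  set N : Matrix n n ℝ := B - r • 1 - vecMulVec v (Pi.single k 1) with hN
  have hNx : ∀ x, N *ᵥ x = B *ᵥ x - r • x - x k • v := by
    intro x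
    rw [hN, sub_mulVec, sub_mulVec, smul_mulVec, one_mulVec, vecMulVec_mulVec]
    simp
  have hdet : IsUnit N.det := by
    rw [isUnit_iff_ne_zero]
    intro h0
    obtain ⟨x, hx0, hx⟩ := exists_mulVec_eq_zero_iff.2 h0
    rw [hNx] at hx
    have hx' : B *ᵥ x = r • x + x k • v := by
      rw [sub_sub, sub_eq_zero] at hx
      exact hx
    have h1 := key 0 x (x k) (fun _ => le_rfl) (by rw [add_zero, hx'])
    have h2 := key 0 (-x) (-x k) (fun _ => le_rfl) (by
      rw [add_zero, mulVec_neg, hx', smul_neg, neg_smul, neg_add])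
    have hk : x k = 0 := le_antisymm (by linarith) h1
    rw [hk, zero_smul, add_zero] at hx'
    obtain ⟨t, i, hnn, hz, -⟩ := exists_shift hB hv hBv x
    have hzero : x + t • v = 0 := by
      by_contra hne
      have := hA.pos_of_mulVec_eq hB (z := x + t • v) (r := r) hnn hne (by
        rw [mulVec_add, mulVec_smul, hx', hBv, smul_add, smul_comm]) i
      simp only [Pi.add_apply, Pi.smul_apply, smul_eq_mul] at this
      linarith
    have ht : t = 0 := by
      have := congrFun hzero k
      simp only [Pi.add_apply, Pi.smul_apply, smul_eq_mul, hk, zero_add, Pi.zero_apply] at this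
      exact (mul_eq_zero.1 this).resolve_right (hv k).ne'
    rw [ht, zero_smul, add_zero] at hzero
    exact hx0 hzero
  set x := N⁻¹ *ᵥ -g with hx
  have e : B *ᵥ x + g = r • x + x k • v := by
    have : N *ᵥ x = -g := by
      rw [hx, mulVec_mulVec, mul_nonsing_inv _ hdet, one_mulVec]
    rw [hNx, sub_sub, sub_eq_iff_eq_add] at this
    rw [this]
    abel
  obtain ⟨K, hK⟩ := exists_forall_ge_of_finite x v hv
  refine ⟨x + K • v, x k, fun i => hK K le_rfl i, key g x _ hg e, ?_⟩
  rw [mulVec_add, mulVec_smul, hBv, smul_add, smul_comm r K, add_right_comm, e]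
  abel

end

/-! ### Reducible matrices -/

lemma IsMetzler.submatrix {m n : ℕ} {A : Matrix (Fin n) (Fin n) ℝ} (hM : A.IsMetzler)
    {f : Fin m → Fin n} (hf : Function.Injective f) : (A.submatrix f f).IsMetzler :=
  fun _ _ hij => hM _ _ (hf.ne hij)

/-- An invariant coordinate line: the remaining vectors come from the `3 × 3` case. -/
lemma HasMetzlerHessenberg.of_invariant_singleton {A : Matrix (Fin 4) (Fin 4) ℝ}
    (hM : A.IsMetzler) {k : Fin 4} (h : ∀ i, i ≠ k → A i k = 0) : A.HasMetzlerHessenberg := by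
  refine .of_submatrix (Equiv.swap 0 k) ?_
  have hM' : (A.submatrix (Equiv.swap 0 k) (Equiv.swap 0 k)).IsMetzler :=
    hM.submatrix (Equiv.injective _)
  have h' : ∀ i : Fin 3, A.submatrix (Equiv.swap 0 k) (Equiv.swap 0 k) i.succ 0 = 0 := by
    intro i
    simp only [submatrix_apply, Equiv.swap_apply_left]
    refine h _ fun h0 => ?_
    rw [Equiv.swap_apply_eq_iff, Equiv.swap_apply_right] at h0
    exact Fin.succ_ne_zero i h0
  generalize A.submatrix (Equiv.swap 0 k) (Equiv.swap 0 k) = A' at hM' h'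
  obtain ⟨T, H, hT, hdet, hHM, hHH, hTH⟩ :=
    HasMetzlerHessenberg.of_isMetzler_three (hM'.submatrix (Fin.succ_injective 3))
  refine ⟨blockUpper 1 0 T, blockUpper (A' 0 0) ((fun j => A' 0 j.succ) ᵥ* T) H, ?_, ?_, ?_, ?_, ?_⟩
  · intro i j
    refine Fin.cases ?_ (fun i => ?_) i <;> refine Fin.cases ?_ (fun j => ?_) j
    · simp
    · simp
    · simp
    · simpa using hT i j
  · rw [det_blockUpper, one_mul]
    exact hdet
  · intro i j
    refine Fin.cases ?_ (fun i => ?_) i <;> refine Fin.cases ?_ (fun j => ?_) j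
    · intro h
      exact absurd rfl h
    · intro _
      simp only [blockUpper_zero_succ, vecMul, dotProduct]
      exact sum_nonneg fun l _ => mul_nonneg (hM' _ _ (Fin.succ_ne_zero l).symm) (hT l j)
    · simp
    · intro hij
      simpa using hHM i j (fun h => hij (by rw [h]))
  · intro i j
    refine Fin.cases ?_ (fun i => ?_) i <;> refine Fin.cases ?_ (fun j => ?_) j
    · simp
    · simp
    · simp
    · intro hij
      simpa using hHH i j (by simpa using hij)
  · nth_rewrite 1 [eq_blockUpper A' h']
    rw [blockUpper_mul_blockUpper, blockUpper_mul_blockUpper, hTH]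
    simp

/-- An invariant coordinate plane: after a permutation the matrix is already upper Hessenberg. -/
lemma HasMetzlerHessenberg.of_invariant_pair {A : Matrix (Fin 4) (Fin 4) ℝ}
    (hM : A.IsMetzler) {a b : Fin 4} (hab : a ≠ b)
    (h : ∀ i, i ≠ a → i ≠ b → A i a = 0 ∧ A i b = 0) : A.HasMetzlerHessenberg := by
  obtain ⟨e, rfl, rfl⟩ : ∃ e : Equiv.Perm (Fin 4), e 0 = a ∧ e 1 = b := by
    have hne : Equiv.swap 0 a b ≠ 0 := by
      rw [Ne, Equiv.swap_apply_eq_iff, Equiv.swap_apply_left]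
      exact hab.symm
    refine ⟨(Equiv.swap 1 (Equiv.swap 0 a b)).trans (Equiv.swap 0 a), ?_, ?_⟩
    · rw [Equiv.trans_apply, Equiv.swap_apply_of_ne_of_ne (by decide) hne.symm,
        Equiv.swap_apply_left]
    · rw [Equiv.trans_apply, Equiv.swap_apply_left, Equiv.swap_apply_self]
  refine .of_submatrix e ⟨1, A.submatrix e e, ?_, by simp, hM.submatrix e.injective, ?_, by simp⟩
  · intro i j
    rw [one_apply]
    split_ifs <;> norm_num
  · have h2 := h (e 2) (e.injective.ne (by decide)) (e.injective.ne (by decide))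
    have h3 := h (e 3) (e.injective.ne (by decide)) (e.injective.ne (by decide))
    intro i j hij
    fin_cases i <;> fin_cases j <;> simp_all

lemma HasMetzlerHessenberg.of_invariant_finset {A : Matrix (Fin 4) (Fin 4) ℝ}
    (hM : A.IsMetzler) {S : Finset (Fin 4)} (hS : S.card = 1 ∨ S.card = 2)
    (h : ∀ i ∉ S, ∀ j ∈ S, A i j = 0) : A.HasMetzlerHessenberg := by
  rcases hS with hS | hS
  · obtain ⟨k, rfl⟩ := card_eq_one.1 hS
    exact .of_invariant_singleton hM fun i hi => h i (by simpa using hi) k (by simp)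
  · obtain ⟨a, b, hab, rfl⟩ := card_eq_two.1 hS
    refine .of_invariant_pair hM hab fun i hia hib => ?_
    have hi : i ∉ ({a, b} : Finset (Fin 4)) := by simp [hia, hib]
    exact ⟨h i hi a (by simp), h i hi b (by simp)⟩

/-- An invariant coordinate hyperplane on which the matrix is indecomposable. The last basis vector
is `(x, 1)`, where `x ≥ 0` is chosen according to the position of the last diagonal entry relative
to the Perron eigenvalue of the upper left block. -/
lemma HasMetzlerHessenberg.of_last_row_eq_zero_of_isIndecomposable {A : Matrix (Fin 4) (Fin 4) ℝ}
    (hM : A.IsMetzler) (hA : ∀ j : Fin 3, A (Fin.last 3) j.castSucc = 0)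
    (hB : (A.submatrix Fin.castSucc Fin.castSucc : Matrix (Fin 3) (Fin 3) ℝ).IsIndecomposable) :
    A.HasMetzlerHessenberg := by
  have hBM : (A.submatrix Fin.castSucc Fin.castSucc : Matrix (Fin 3) (Fin 3) ℝ).IsMetzler :=
    hM.submatrix (Fin.castSucc_injective 3)
  obtain ⟨r, v, hv, hBv⟩ := hB.exists_pos_eigenvector hBM
  have hg : ∀ i : Fin 3, 0 ≤ A i.castSucc (Fin.last 3) := fun i => hM _ _ (Fin.castSucc_ne_last i)
  rcases lt_trichotomy (A (Fin.last 3) (Fin.last 3)) r with hd | hd | hd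
  · obtain ⟨T, H, hT, hdet, hHM, hHH, hTH, K₀, hK⟩ := exists_hessenberg_basis_cone hBM hv hBv hg
    obtain ⟨y, hy, hTy⟩ := hK (max K₀ 0) (le_max_left _ _)
    have hd' : 0 < r - A (Fin.last 3) (Fin.last 3) := sub_pos.2 hd
    set k := max K₀ 0 / (r - A (Fin.last 3) (Fin.last 3))
    have hk0 : 0 ≤ k := div_nonneg (le_max_right _ _) hd'.le
    have hk1 : k * (r - A (Fin.last 3) (Fin.last 3)) = max K₀ 0 := div_mul_cancel₀ _ hd'.ne'
    refine .of_last_row_eq_zero hA hT hdet hHM hHH hTH (x := k • v) (y := y)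
      (fun i => mul_nonneg hk0 (hv i).le) hy ?_
    rw [hTy, mulVec_smul, hBv, ← hk1]
    ext i
    simp only [Pi.add_apply, Pi.smul_apply, smul_eq_mul]
    ring
  · obtain ⟨T, H, hT, hdet, hHM, hHH, hTH, K₀, hK⟩ :=
      exists_hessenberg_basis_cone hBM hv hBv (g := 0) (fun _ => le_rfl)
    obtain ⟨y, hy, hTy⟩ := hK (max K₀ 1) (le_max_left _ _)
    have hK1 : 0 < max K₀ 1 := lt_max_of_lt_right one_pos
    obtain ⟨x, a, hx, ha, hxa⟩ := hB.exists_nonneg_solution hBM hv hBv hg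
    refine .of_last_row_eq_zero hA hT hdet hHM hHH hTH (x := x) (y := (a / max K₀ 1) • y)
      hx (fun i => mul_nonneg (div_nonneg ha hK1.le) (hy i)) ?_
    rw [hxa, mulVec_smul, hTy, add_zero, smul_smul, div_mul_cancel₀ _ hK1.ne', hd]
  · obtain ⟨T, H, hT, hdet, hHM, hHH, hTH⟩ := HasMetzlerHessenberg.of_isMetzler_three hBM
    obtain ⟨x, hx, hxd⟩ := exists_nonneg_solution_of_lt hBM hv hBv hd hg
    refine .of_last_row_eq_zero hA hT hdet hHM hHH hTH (x := x) (y := 0) hx (fun _ => le_rfl) ?_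
    rw [hxd, mulVec_zero, add_zero]

lemma HasMetzlerHessenberg.of_last_row_eq_zero_of_isMetzler {A : Matrix (Fin 4) (Fin 4) ℝ}
    (hM : A.IsMetzler) (hA : ∀ j : Fin 3, A (Fin.last 3) j.castSucc = 0) :
    A.HasMetzlerHessenberg := by
  by_cases hB : (A.submatrix Fin.castSucc Fin.castSucc : Matrix (Fin 3) (Fin 3) ℝ).IsIndecomposable
  · exact .of_last_row_eq_zero_of_isIndecomposable hM hA hB
  · unfold IsIndecomposable at hB
    push Not at hB
    obtain ⟨S, hS, hSu, h⟩ := hB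
    have h1 := card_pos.2 hS
    have h2 := (card_lt_iff_ne_univ S).2 hSu
    rw [Fintype.card_fin] at h2
    refine .of_invariant_finset hM (S := S.map Fin.castSuccEmb) (by rw [card_map]; omega) ?_
    intro i hi j hj
    obtain ⟨j, hj', rfl⟩ := mem_map.1 hj
    revert hi
    refine Fin.lastCases ?_ (fun i => ?_) i
    · intro _
      exact hA j
    · intro hi
      exact h i (fun h' => hi (mem_map_of_mem _ h')) j hj'

lemma HasMetzlerHessenberg.of_not_isIndecomposable {A : Matrix (Fin 4) (Fin 4) ℝ}
    (hM : A.IsMetzler) (hA : ¬ A.IsIndecomposable) : A.HasMetzlerHessenberg := by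
  unfold IsIndecomposable at hA
  push Not at hA
  obtain ⟨S, hS, hSu, h⟩ := hA
  have h1 := card_pos.2 hS
  have h2 := (card_lt_iff_ne_univ S).2 hSu
  rw [Fintype.card_fin] at h2
  by_cases h3 : S.card = 3
  · have hc : Sᶜ.card = 1 := by rw [card_compl, Fintype.card_fin, h3]
    obtain ⟨k, hk⟩ := card_eq_one.1 hc
    have hkS : ∀ j, j ∉ S ↔ j = k := fun j => by rw [← mem_compl, hk, mem_singleton]
    refine .of_submatrix (Equiv.swap (Fin.last 3) k)
      (.of_last_row_eq_zero_of_isMetzler (hM.submatrix (Equiv.injective _)) fun j => ?_)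
    rw [submatrix_apply, Equiv.swap_apply_left]
    refine h k ((hkS k).2 rfl) _ (not_not.1 fun hj => ?_)
    rw [hkS, Equiv.swap_apply_eq_iff, Equiv.swap_apply_right] at hj
    exact Fin.castSucc_ne_last j hj
  · exact .of_invariant_finset hM (by omega) h

lemma HasMetzlerHessenberg.of_isMetzler_four {A : Matrix (Fin 4) (Fin 4) ℝ} (hM : A.IsMetzler) :
    A.HasMetzlerHessenberg := by
  by_cases hA : A.IsIndecomposable
  · have hoff : ∀ i j, i ≠ j →
        (A - (A.trace / 4) • (1 : Matrix (Fin 4) (Fin 4) ℝ)) i j = A i j := by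
      intro i j hij
      simp [one_apply_ne hij]
    refine .of_sub_smul_one (A.trace / 4) (.of_isIndecomposable ?_ ?_ ?_)
    · intro i j hij
      rw [hoff i j hij]
      exact hM i j hij
    · rw [trace_sub, trace_smul, trace_one, Fintype.card_fin]
      simp
    · intro S hS hSu
      obtain ⟨i, hi, j, hj, hij⟩ := hA S hS hSu
      refine ⟨i, hi, j, hj, ?_⟩
      rwa [hoff i j (by rintro rfl; exact hi hj)]
  · exact .of_not_isIndecomposable hM hA

end Matrix

theorem mainTheorem2 (A : Matrix (Fin 4) (Fin 4) ℝ) (hA : A.IsMetzler) :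
    ∃ T : Matrix (Fin 4) (Fin 4) ℝ, T.IsNonneg ∧ IsUnit T ∧
      (T⁻¹ * A * T).IsMetzler ∧ (T⁻¹ * A * T).IsUpperHessenberg := by
  obtain ⟨T, H, hT, hdet, hM, hH, h⟩ := Matrix.HasMetzlerHessenberg.of_isMetzler_four hA
  have e : T⁻¹ * A * T = H := by
    rw [Matrix.mul_assoc, h, Matrix.nonsing_inv_mul_cancel_left _ _ hdet]
  exact ⟨T, hT, (Matrix.isUnit_iff_isUnit_det T).2 hdet, e ▸ hM, e ▸ hH⟩
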